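/- Let $n\ge 1$, $0<\alpha<n$, $1<p<\frac n\alpha$ and $\frac1q=\frac1p-\frac\alpha n$. Let $1<s\le\infty$, $s'=\frac{s}{s-1}$ (with $s'=1$ and $\frac ns=0$ if $s=\infty$), and let $\Omega$ be a (real- or complex-valued) function on $\mathbb R^n$ that is homogeneous of degree zero on $\mathbb R^n\setminus\{0\}$ with $\Omega\in L_s(S^{n-1})$. Put $$\overline T_{\Omega,\alpha}f(x)=\int_{\mathbb R^n}\frac{\Omega(x-y)}{|x-y|^{n-\alpha}}f(y)\,dy,\qquad M_{\Omega,\alpha}f(x)=\sup_{t>0}|B(x,t)|^{-1+\frac\alpha n}\int_{B(x,t)}|\Omega(x-y)|\,|f(y)|\,dy .$$ For a positive measurable function $\varphi$ on $\mathbb R^n\times(0,\infty)$ and $1\le u<\infty$ let $VM_{u,\varphi}$ be the space of all $f\in L_u^{\rm loc}(\mathbb R^n)$ such that $$\|f\|_{VM_{u,\varphi}}=\sup_{x\in\mathbb R^n,\,r>0}\varphi(x,r)^{-1}\|f\|_{L_u(B(x,r))}<\infty\quad\text{and}\quad \lim_{r\to0}\ \sup_{x\in\mathbb R^n}\varphi(x,r)^{-1}\|f\|_{L_u(B(x,r))}=0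 .$$ Let $\varphi_1,\varphi_2$ be positive measurable functions on $\mathbb R^n\times(0,\infty)$ such that, for $(u,\varphi)=(p,\varphi_1)$ and for $(u,\varphi)=(q,\varphi_2)$, $$\lim_{t\to0}\ \sup_{x\in\mathbb R^n}\frac{t^{n/u}}{\varphi(x,t)}=0\qquad\text{and}\qquad \inf_{t>1}\ \sup_{x\in\mathbb R^n}\frac{t^{n/u}}{\varphi(x,t)}>0 .$$ Suppose that at least one of the following holds, with a constant $C_0$ that does not depend on $x\in\mathbb R^n$ and $r>0$: (a) $s'\le p$, and $$\int_\delta^\infty \sup_{x\in\mathbb R^n}\varphi_1(x,t)\,\frac{dt}{t^{\frac nq+1}}<\infty\ \text{ for every }\delta>0,\qquad \int_r^\infty\varphi_1(x,t)\,\frac{dt}{t^{\frac nq+1}}\le C_0\,\frac{\varphi_2(x,r)}{r^{\frac nq}}\ \text{ for all }x\in\mathbb R^n,\ r>0;$$ (b) $q<s$, $\inf_{x\in\mathbb R^n,\,r>0}\varphi_2(x,r)>0$, and $$\int_{\delta}^\infty \sup_{x\in\mathbb R^n}\varphi_1(x,t)\,\frac{dt}{t^{\frac nq-\frac ns+1}}<\infty\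 \text{ for every }\delta>0,\qquad \int_r^\infty\varphi_1(x,t)\,\frac{dt}{t^{\frac nq-\frac ns+1}}\le C_0\,\frac{\varphi_2(x,r)}{r^{\frac nq-\frac ns}}\ \text{ for all }x\in\mathbb R^n,\ r>0.$$ Then $M_{\Omega,\alpha}$ and $\overline T_{\Omega,\alpha}$ are bounded from $VM_{p,\varphi_1}$ to $VM_{q,\varphi_2}$: for every $f\in VM_{p,\varphi_1}$, $M_{\Omega,\alpha}f$ is finite almost everywhere, the integral defining $\overline T_{\Omega,\alpha}f(x)$ converges absolutely for almost every $x$, both $M_{\Omega,\alpha}f$ and $\overline T_{\Omega,\alpha}f$ belong to $VM_{q,\varphi_2}$, and $$\|M_{\Omega,\alpha}f\|_{VM_{q,\varphi_2}}\le C\,\|f\|_{VM_{p,\varphi_1}},\qquad \|\overline T_{\Omega,\alpha}f\|_{VM_{q,\varphi_2}}\le C\,\|f\|_{VM_{p,\varphi_1}},$$ with a constant $C$ that does not depend on $f$. -/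

import Mathlib

open MeasureTheory Filter Topology Set
open scoped ENNReal NNReal

noncomputable section

namespace RoughMorrey

/-- `Ω` is homogeneous of degree zero on `ℝⁿ \ {0}`. -/
def HomogZero {n : ℕ} {𝕜 : Type*} (Ω : EuclideanSpace ℝ (Fin n) → 𝕜) : Prop :=
  ∀ c : ℝ, 0 < c → ∀ x : EuclideanSpace ℝ (Fin n), x ≠ 0 → Ω (c • x) = Ω x

/-- The restriction of `Ω` to the unit sphere `Sⁿ⁻¹` belongs to `L_s(Sⁿ⁻¹)`, with respect to the
surface measure. -/
def MemLpSphere {n : ℕ} {𝕜 : Type*} [RCLike 𝕜] (Ω : EuclideanSpace ℝ (Fin n) → 𝕜)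
    (s : ℝ≥0∞) : Prop :=
  MemLp (fun θ : Metric.sphere (0 : EuclideanSpace ℝ (Fin n)) 1 => Ω θ) s
    (volume : Measure (EuclideanSpace ℝ (Fin n))).toSphere

/-- The rough fractional integral
`T̄_{Ω,α} f (x) = ∫ Ω(x - y) |x - y|^{-(n - α)} f(y) dy`. -/
def fracIntegral {n : ℕ} {𝕜 : Type*} [RCLike 𝕜] (Ω : EuclideanSpace ℝ (Fin n) → 𝕜) (α : ℝ)
    (f : EuclideanSpace ℝ (Fin n) → 𝕜) (x : EuclideanSpace ℝ (Fin n)) : 𝕜 :=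
  ∫ y, (Ω (x - y) / ((‖x - y‖ ^ ((n : ℝ) - α) : ℝ) : 𝕜)) * f y

/-- The integral that defines `T̄_{Ω,α} f (x)` converges absolutely. -/
def FracIntegralConverges {n : ℕ} {𝕜 : Type*} [RCLike 𝕜] (Ω : EuclideanSpace ℝ (Fin n) → 𝕜)
    (α : ℝ) (f : EuclideanSpace ℝ (Fin n) → 𝕜) (x : EuclideanSpace ℝ (Fin n)) : Prop :=
  Integrable (fun y => (Ω (x - y) / ((‖x - y‖ ^ ((n : ℝ) - α) : ℝ) : 𝕜)) * f y)

/-- The rough fractional maximal function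
`M_{Ω,α} f (x) = sup_{t > 0} |B(x,t)|^{-1 + α/n} ∫_{B(x,t)} |Ω(x - y)| |f(y)| dy`,
with values in `[0, ∞]`. -/
def fracMaximal {n : ℕ} {𝕜 : Type*} [RCLike 𝕜] (Ω : EuclideanSpace ℝ (Fin n) → 𝕜) (α : ℝ)
    (f : EuclideanSpace ℝ (Fin n) → 𝕜) (x : EuclideanSpace ℝ (Fin n)) : ℝ≥0∞ :=
  ⨆ (t : ℝ) (_ : 0 < t), volume (Metric.ball x t) ^ (-1 + α / (n : ℝ)) *
    ∫⁻ y in Metric.ball x t, ‖Ω (x - y)‖ₑ * ‖f y‖ₑ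

/-- `φ(x, r)` is a positive measurable function on `ℝⁿ × (0, ∞)`; values at `r ≤ 0` play no
role. -/
def IsWeight {n : ℕ} (φ : EuclideanSpace ℝ (Fin n) → ℝ → ℝ) : Prop :=
  (∀ x r, 0 < r → 0 < φ x r) ∧
    Measurable (fun z : EuclideanSpace ℝ (Fin n) × Ioi (0 : ℝ) => φ z.1 z.2)

/-- The quotient `φ(x, r)⁻¹ ‖f‖_{L_p(B(x, r))}`. The codomain is general, so that it applies both
to scalar functions and to `[0, ∞]`-valued ones. -/
def localQuot {n : ℕ} {ε : Type*} [ENorm ε] (p : ℝ)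
    (φ : EuclideanSpace ℝ (Fin n) → ℝ → ℝ) (f : EuclideanSpace ℝ (Fin n) → ε)
    (x : EuclideanSpace ℝ (Fin n)) (r : ℝ) : ℝ≥0∞ :=
  eLpNorm f (ENNReal.ofReal p) (volume.restrict (Metric.ball x r)) / ENNReal.ofReal (φ x r)

/-- The generalized Morrey norm
`‖f‖_{M_{p,φ}} = ‖f‖_{VM_{p,φ}} = sup_{x, r > 0} φ(x, r)⁻¹ ‖f‖_{L_p(B(x, r))}`. -/
def morreyNorm {n : ℕ} {ε : Type*} [ENorm ε] (p : ℝ)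
    (φ : EuclideanSpace ℝ (Fin n) → ℝ → ℝ) (f : EuclideanSpace ℝ (Fin n) → ε) : ℝ≥0∞ :=
  ⨆ (x : EuclideanSpace ℝ (Fin n)) (r : ℝ) (_ : 0 < r), localQuot p φ f x r

/-- `f ∈ L_p^loc(ℝⁿ)`. -/
def MemLpLoc {n : ℕ} {ε : Type*} [TopologicalSpace ε] [ContinuousENorm ε] (p : ℝ)
    (f : EuclideanSpace ℝ (Fin n) → ε) : Prop :=
  ∀ K : Set (EuclideanSpace ℝ (Fin n)), IsCompact K →
    MemLp f (ENNReal.ofReal p) (volume.restrict K)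

/-- The generalized Morrey space `M_{p,φ}`. -/
def MemMorrey {n : ℕ} {ε : Type*} [TopologicalSpace ε] [ContinuousENorm ε] (p : ℝ)
    (φ : EuclideanSpace ℝ (Fin n) → ℝ → ℝ) (f : EuclideanSpace ℝ (Fin n) → ε) : Prop :=
  MemLpLoc p f ∧ morreyNorm p φ f < ∞

/-- The vanishing generalized Morrey space `VM_{p,φ}`: the functions of `M_{p,φ}` such that
`sup_x φ(x, r)⁻¹ ‖f‖_{L_p(B(x, r))} → 0` as `r → 0`. -/
def MemVanishingMorrey {n : ℕ} {ε : Type*} [TopologicalSpace ε] [ContinuousENorm ε] (p : ℝ)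
    (φ : EuclideanSpace ℝ (Fin n) → ℝ → ℝ) (f : EuclideanSpace ℝ (Fin n) → ε) : Prop :=
  MemMorrey p φ f ∧
    Tendsto (fun r : ℝ => ⨆ x : EuclideanSpace ℝ (Fin n), localQuot p φ f x r) (𝓝[>] 0) (𝓝 0)

/-- The two admissibility conditions on a weight `φ` for the exponent `p`:
`lim_{t → 0} sup_x t^{n/p} / φ(x, t) = 0` and `inf_{t > 1} sup_x t^{n/p} / φ(x, t) > 0`. -/
def Admissible {n : ℕ} (p : ℝ) (φ : EuclideanSpace ℝ (Fin n) → ℝ → ℝ) : Prop :=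
  Tendsto (fun t : ℝ => ⨆ x : EuclideanSpace ℝ (Fin n),
      ENNReal.ofReal (t ^ ((n : ℝ) / p) / φ x t)) (𝓝[>] 0) (𝓝 0) ∧
    0 < ⨅ (t : ℝ) (_ : 1 < t), ⨆ x : EuclideanSpace ℝ (Fin n),
      ENNReal.ofReal (t ^ ((n : ℝ) / p) / φ x t)

/-- `∫_δ^∞ sup_x φ(x, t) t^{-κ-1} dt < ∞` for every `δ > 0`. -/
def SupTailFinite {n : ℕ} (κ : ℝ) (φ : EuclideanSpace ℝ (Fin n) → ℝ → ℝ) : Prop :=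
  ∀ δ : ℝ, 0 < δ →
    ∫⁻ t in Ioi δ, (⨆ x : EuclideanSpace ℝ (Fin n), ENNReal.ofReal (φ x t)) *
      ENNReal.ofReal (t ^ (-κ - 1)) < ∞

/-- `∫_r^∞ φ₁(x, t) t^{-κ-1} dt ≤ C₀ φ₂(x, r) r^{-κ}` with `C₀` independent of `x` and `r > 0`. -/
def TailBound {n : ℕ} (κ : ℝ) (φ₁ φ₂ : EuclideanSpace ℝ (Fin n) → ℝ → ℝ) : Prop :=
  ∃ C₀ : ℝ≥0, ∀ (x : EuclideanSpace ℝ (Fin n)) (r : ℝ), 0 < r →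
    ∫⁻ t in Ioi r, ENNReal.ofReal (φ₁ x t) * ENNReal.ofReal (t ^ (-κ - 1)) ≤
      C₀ * ENNReal.ofReal (φ₂ x r / r ^ κ)

/-- `inf_{x, r > 0} φ(x, r) > 0`. -/
def BoundedBelow {n : ℕ} (φ : EuclideanSpace ℝ (Fin n) → ℝ → ℝ) : Prop :=
  ∃ c : ℝ, 0 < c ∧ ∀ x r, 0 < r → c ≤ φ x r

end RoughMorrey

end

noncomputable section

namespace RoughMorrey

/-! ### Radial integrals, polar coordinates, and level sets of the homogeneous kernel -/

section

/-! Up to a constant, both operators are dominated pointwise by H = K * |f| with K(x) = |Ω(x)|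
|x|^{α-n} (`enorm_fracIntegral_le`, `fracMaximal_le`). Everything therefore rests on one local
estimate, `exists_ballNorm_roughKernel_le`: ‖H‖_{L_q(B(x,R))} ≤ C R^κ ∫_R^∞ t^{-κ-1}
‖f‖_{L_p(B(x,t))} dt, where κ = n/q in case (a) and κ = n/q - n/s in case (b).

To prove it, f is cut at B(x,2R). The near part needs only a global L_p-L_q bound. In polar
coordinates K is explicit on every ray, so K behaves like a weak L_r function with r = n/(n-α) as
soon as Ω is in L_r of the sphere, which both cases guarantee. Since 1/p + 1/r = 1 + 1/q, the weak
Young inequality `exists_lintegral_conv_rpow_le` applies. Monotonicity of t ↦ ‖f‖_{L_p(B(x,t))} then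
turns the bound into a tail integral.

For the far part, the distance from y to a point of the ball is at least half its distance to the
centre, and the negative power of the latter is a superposition of indicators of balls; this creates
the integral in t. If s' ≤ p, Hölder with Ω in L_{p'} and f in L_p bounds H uniformly on the ball
(`exists_ballNorm_far_le_of_conj`). If q < s, an argument of Minkowski type places the L_q norm on
translates of Ω (`exists_ballNorm_far_le_of_lt`); controlling it by the L_s norm costs (ρ/R)^{n/s}
at distance ρ, which is the loss in κ.

Inserting the tail condition on the weights gives boundedness. For the vanishing property the tail
is cut at a small δ: below δ the quotients of f are small, and above δ the integral is at most a
finite constant, uniformly in x, multiplied by R^κ/φ₂(x,R). This last factor tends to 0 by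
admissibility of φ₂ in case (a), and because φ₂ is bounded below and κ > 0 in case (b). -/

theorem lintegral_Ioo_rpow {a : ℝ} (ha : 0 < a) {c : ℝ} (hc : 0 ≤ c) :
    ∫⁻ t in Ioo 0 c, ENNReal.ofReal (t ^ (a - 1)) = ENNReal.ofReal (c ^ a / a) := by
  have h1 : IntervalIntegrable (fun t : ℝ => t ^ (a - 1)) volume 0 c :=
    intervalIntegral.intervalIntegrable_rpow' (by linarith)
  rw [restrict_Ioo_eq_restrict_Ioc, ← ofReal_integral_eq_lintegral_ofReal h1.1]
  · rw [← intervalIntegral.integral_of_le hc, integral_rpow (Or.inl (by linarith))]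
    simp [ha.ne']
  · filter_upwards [ae_restrict_mem measurableSet_Ioc] with t ht
    exact Real.rpow_nonneg ht.1.le _

theorem lintegral_Ioi_rpow_neg {b : ℝ} (hb : 0 < b) {c : ℝ} (hc : 0 < c) :
    ∫⁻ t in Ioi c, ENNReal.ofReal (t ^ (-b - 1)) = ENNReal.ofReal (c ^ (-b) / b) := by
  have h1 : IntegrableOn (fun t : ℝ => t ^ (-b - 1)) (Ioi c) :=
    integrableOn_Ioi_rpow_of_lt (by linarith) hc
  rw [← ofReal_integral_eq_lintegral_ofReal h1]
  · rw [integral_Ioi_rpow_of_lt (by linarith) hc]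
    congr 1
    rw [show -b - 1 + 1 = -b by ring]
    field_simp
  · filter_upwards [ae_restrict_mem measurableSet_Ioi] with t ht
    exact Real.rpow_nonneg (hc.trans ht).le _

/-- Supplies the degenerate endpoints u = ∞ and u = 0 in the two formulas below, which then hold for
extended numbers without a finiteness assumption. -/
theorem lintegral_Ioi_zero_rpow_eq_top (a : ℝ) :
    ∫⁻ t in Ioi (0 : ℝ), ENNReal.ofReal (t ^ a) = ∞ := by
  by_contra h
  apply not_integrableOn_Ioi_rpow a
  refine ⟨by fun_prop, ?_⟩
  rw [hasFiniteIntegral_iff_ofReal]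
  · exact lt_top_iff_ne_top.2 h
  · filter_upwards [ae_restrict_mem measurableSet_Ioi] with t ht
    exact Real.rpow_nonneg (le_of_lt ht) _

/-- `∫_{0 < t < u} t^{a-1} dt = u^a / a` for every extended number `u`. -/
theorem lintegral_rpow_indicator_lt {a : ℝ} (ha : 0 < a) (u : ℝ≥0∞) :
    ∫⁻ t in Ioi (0 : ℝ), {t : ℝ | ENNReal.ofReal t < u}.indicator
      (fun t => ENNReal.ofReal (t ^ (a - 1))) t = ENNReal.ofReal (1 / a) * u ^ a := by
  have hm : MeasurableSet {t : ℝ | ENNReal.ofReal t < u} :=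
    measurableSet_lt ENNReal.measurable_ofReal measurable_const
  rw [lintegral_indicator hm, Measure.restrict_restrict hm]
  rcases eq_or_ne u ∞ with rfl | hu
  · simp only [ENNReal.ofReal_lt_top, ofPred_true, univ_inter, ENNReal.top_rpow_of_pos ha]
    rw [lintegral_Ioi_zero_rpow_eq_top, ENNReal.mul_top]
    simpa using ha
  · have : {t : ℝ | ENNReal.ofReal t < u} ∩ Ioi 0 = Ioo 0 u.toReal := by
      ext t
      simp only [mem_inter_iff, mem_ofPred_eq, mem_Ioi, mem_Ioo]
      constructor
      · rintro ⟨h1, h2⟩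
        exact ⟨h2, (ENNReal.ofReal_lt_iff_lt_toReal h2.le hu).1 h1⟩
      · rintro ⟨h2, h1⟩
        exact ⟨(ENNReal.ofReal_lt_iff_lt_toReal h2.le hu).2 h1, h2⟩
    rw [this, lintegral_Ioo_rpow ha ENNReal.toReal_nonneg, div_eq_mul_one_div, mul_comm,
      ENNReal.ofReal_mul (by positivity), ENNReal.toReal_rpow, ENNReal.ofReal_toReal]
    exact ENNReal.rpow_ne_top_of_nonneg ha.le hu

/-- `∫_{t ≥ u} t^{-b-1} dt = u^{-b} / b` for every extended number `u`. -/
theorem lintegral_rpow_indicator_ge {b : ℝ} (hb : 0 < b) (u : ℝ≥0∞) :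
    ∫⁻ t in Ioi (0 : ℝ), {t : ℝ | u ≤ ENNReal.ofReal t}.indicator
      (fun t => ENNReal.ofReal (t ^ (-b - 1))) t = ENNReal.ofReal (1 / b) * u ^ (-b) := by
  have hm : MeasurableSet {t : ℝ | u ≤ ENNReal.ofReal t} :=
    measurableSet_le measurable_const ENNReal.measurable_ofReal
  rw [lintegral_indicator hm, Measure.restrict_restrict hm]
  rcases eq_or_ne u ∞ with rfl | hu
  · simp [hb]
  rcases eq_or_ne u 0 with rfl | hu0
  · simp only [zero_le, ofPred_true, univ_inter]
    rw [lintegral_Ioi_zero_rpow_eq_top, ENNReal.zero_rpow_of_neg (by linarith), ENNReal.mul_top]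
    simpa using hb
  · have hpos : 0 < u.toReal := ENNReal.toReal_pos hu0 hu
    have : {t : ℝ | u ≤ ENNReal.ofReal t} ∩ Ioi 0 = Ici u.toReal := by
      ext t
      simp only [mem_inter_iff, mem_ofPred_eq, mem_Ioi, mem_Ici]
      constructor
      · rintro ⟨h1, h2⟩
        exact (ENNReal.le_ofReal_iff_toReal_le hu h2.le).1 h1
      · intro h1
        have h2 := hpos.trans_le h1
        exact ⟨(ENNReal.le_ofReal_iff_toReal_le hu h2.le).2 h1, h2⟩
    rw [this, ← restrict_Ioi_eq_restrict_Ici, lintegral_Ioi_rpow_neg hb hpos,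
      div_eq_mul_one_div, mul_comm,
      ENNReal.ofReal_mul (by positivity), ← ENNReal.ofReal_rpow_of_pos hpos,
      ENNReal.ofReal_toReal hu]

variable {n : ℕ}

/-- Integration in polar coordinates. -/
theorem lintegral_polar [NeZero n] (g : EuclideanSpace ℝ (Fin n) → ℝ≥0∞) (hg : Measurable g) :
    ∫⁻ x, g x = ∫⁻ θ : Metric.sphere (0 : EuclideanSpace ℝ (Fin n)) 1,
      (∫⁻ t in Ioi (0 : ℝ), ENNReal.ofReal (t ^ ((n : ℝ) - 1)) *
        g (t • (θ : EuclideanSpace ℝ (Fin n))))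
        ∂(volume : Measure (EuclideanSpace ℝ (Fin n))).toSphere := by
  have hn : 0 < n := Nat.pos_of_ne_zero (NeZero.ne n)
  have hmp := (volume : Measure (EuclideanSpace ℝ (Fin n))).measurePreserving_homeomorphUnitSphereProd
  calc ∫⁻ x, g x = ∫⁻ x : ({(0)}ᶜ : Set (EuclideanSpace ℝ (Fin n))), g x
        ∂((volume : Measure (EuclideanSpace ℝ (Fin n))).comap (↑)) := by
        rw [lintegral_subtype_comap (measurableSet_singleton _).compl, restrict_compl_singleton]
    _ = ∫⁻ z, g (z.2.1 • z.1.1) ∂((volume : Measure (EuclideanSpace ℝ (Fin n))).toSphere.prod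
          (Measure.volumeIoiPow (Module.finrank ℝ (EuclideanSpace ℝ (Fin n)) - 1))) := by
        rw [← hmp.lintegral_comp (by fun_prop)]
        refine lintegral_congr fun x => ?_
        congr 1
        have hx : ‖(x : EuclideanSpace ℝ (Fin n))‖ ≠ 0 :=
          norm_ne_zero_iff.2 x.2
        simp [smul_smul, hx]
    _ = _ := by
        rw [lintegral_prod _ (by fun_prop)]
        refine lintegral_congr fun θ => ?_
        rw [Measure.volumeIoiPow, lintegral_withDensity_eq_lintegral_mul _ (by fun_prop)
          (by fun_prop), finrank_euclideanSpace_fin]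
        simp only [Pi.mul_apply]
        rw [lintegral_subtype_comap measurableSet_Ioi (fun t : ℝ => ENNReal.ofReal (t ^ (n - 1)) *
          g (t • (θ : EuclideanSpace ℝ (Fin n))))]
        refine setLIntegral_congr_fun measurableSet_Ioi fun t ht => ?_
        -- The natural subtraction n - 1 is genuine because n ≥ 1.
        rw [← Real.rpow_natCast, Nat.cast_sub hn, Nat.cast_one]

theorem HomogZero.smul_sphere {W : EuclideanSpace ℝ (Fin n) → ℝ≥0∞} (hW : HomogZero W) {t : ℝ}
    (ht : 0 < t) (θ : Metric.sphere (0 : EuclideanSpace ℝ (Fin n)) 1) :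
    W (t • (θ : EuclideanSpace ℝ (Fin n))) = W θ :=
  hW t ht _ (by intro h; have := θ.2; simp [h] at this)

theorem norm_smul_sphere {t : ℝ} (ht : 0 < t)
    (θ : Metric.sphere (0 : EuclideanSpace ℝ (Fin n)) 1) :
    ‖t • (θ : EuclideanSpace ℝ (Fin n))‖ = t := by
  simp [norm_smul, ht.le]

/-- The integral of a power of a homogeneous function over a centred ball. -/
theorem lintegral_ball_homog [NeZero n] {W : EuclideanSpace ℝ (Fin n) → ℝ≥0∞} (hWm : Measurable W)
    (hW : HomogZero W) (u : ℝ) {R : ℝ} (hR : 0 < R) :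
    ∫⁻ x in Metric.ball 0 R, W x ^ u =
      ENNReal.ofReal (R ^ (n : ℝ) / n) *
      ∫⁻ θ : Metric.sphere (0 : EuclideanSpace ℝ (Fin n)) 1, W θ ^ u
        ∂(volume : Measure (EuclideanSpace ℝ (Fin n))).toSphere := by
  have hn : 0 < (n : ℝ) := Nat.cast_pos.2 (Nat.pos_of_ne_zero (NeZero.ne n))
  rw [← lintegral_indicator Metric.isOpen_ball.measurableSet, lintegral_polar _
    ((hWm.pow_const u).indicator Metric.isOpen_ball.measurableSet),
    ← lintegral_const_mul _ (by fun_prop)]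
  refine lintegral_congr fun θ => ?_
  rw [← lintegral_Ioo_rpow hn hR.le, ← lintegral_mul_const _ (by fun_prop),
    ← lintegral_indicator measurableSet_Ioo, ← lintegral_indicator measurableSet_Ioi]
  refine lintegral_congr fun t => ?_
  by_cases ht : 0 < t
  · by_cases htR : t < R
    · simp only [indicator, mem_Ioi, ht, mem_Ioo, htR, Metric.mem_ball, dist_zero_right,
        norm_smul_sphere ht, hW.smul_sphere ht, if_true, and_self]
    · simp [indicator, mem_Ioi, ht, mem_Ioo, htR, Metric.mem_ball, dist_zero_right,
        norm_smul_sphere ht]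
  · simp [indicator, ht]

/-- The kernel `W(x) |x|^{-β}`. -/
def roughKernel (W : EuclideanSpace ℝ (Fin n) → ℝ≥0∞) (β : ℝ)
    (x : EuclideanSpace ℝ (Fin n)) : ℝ≥0∞ :=
  W x * ENNReal.ofReal (‖x‖ ^ (-β))

@[fun_prop]
theorem measurable_roughKernel {W : EuclideanSpace ℝ (Fin n) → ℝ≥0∞} (hW : Measurable W) (β : ℝ) :
    Measurable (roughKernel W β) := by
  unfold roughKernel
  fun_prop

theorem roughKernel_smul_sphere {W : EuclideanSpace ℝ (Fin n) → ℝ≥0∞} (hW : HomogZero W) (β : ℝ)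
    {t : ℝ} (ht : 0 < t) (θ : Metric.sphere (0 : EuclideanSpace ℝ (Fin n)) 1) :
    roughKernel W β (t • (θ : EuclideanSpace ℝ (Fin n))) = W θ * ENNReal.ofReal (t ^ (-β)) := by
  rw [roughKernel, hW.smul_sphere ht, norm_smul_sphere ht]

/-- Along a ray the kernel is a constant multiple of a negative power of t, so each superlevel set
is an initial segment of the ray with an explicit endpoint. -/
theorem lt_mul_rpow_iff {w : ℝ≥0∞} {r m τ t : ℝ} (hr : 0 < r) (hm : 0 < m) (hτ : 0 < τ)
    (ht : 0 < t) : ENNReal.ofReal τ < (w * ENNReal.ofReal (t ^ (-(m / r)))) ^ r ↔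
      ENNReal.ofReal t < (w ^ r / ENNReal.ofReal τ) ^ (1 / m) := by
  have hτ' : ENNReal.ofReal τ ≠ 0 := by simpa using hτ
  have ht' : ENNReal.ofReal (t ^ m) ≠ 0 := by simpa using Real.rpow_pos_of_pos ht m
  have h1 : (w * ENNReal.ofReal (t ^ (-(m / r)))) ^ r = w ^ r / ENNReal.ofReal (t ^ m) := by
    rw [ENNReal.mul_rpow_of_nonneg _ _ hr.le, ENNReal.ofReal_rpow_of_pos (by positivity),
      ← Real.rpow_mul ht.le, show -(m / r) * r = -m by field_simp, Real.rpow_neg ht.le,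
      ENNReal.ofReal_inv_of_pos (by positivity), div_eq_mul_inv]
  rw [h1, ENNReal.lt_div_iff_mul_lt (Or.inl ht') (Or.inl ENNReal.ofReal_ne_top), mul_comm,
    ← ENNReal.lt_div_iff_mul_lt (Or.inl hτ') (Or.inl ENNReal.ofReal_ne_top),
    ← ENNReal.ofReal_rpow_of_pos ht]
  rw [one_div, ENNReal.lt_rpow_inv_iff hm]

/-- The part of the kernel above a level is integrable. -/
theorem lintegral_roughKernel_gt [NeZero n] {W : EuclideanSpace ℝ (Fin n) → ℝ≥0∞}
    (hWm : Measurable W) (hW : HomogZero W) {r : ℝ} (hr : 1 < r) {τ : ℝ} (hτ : 0 < τ) :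
    ∫⁻ x, {x | ENNReal.ofReal τ < roughKernel W (n / r) x ^ r}.indicator (roughKernel W (n / r)) x
      = (ENNReal.ofReal (1 / (n * (1 - 1 / r))) *
        ∫⁻ θ : Metric.sphere (0 : EuclideanSpace ℝ (Fin n)) 1, W θ ^ r
        ∂(volume : Measure (EuclideanSpace ℝ (Fin n))).toSphere) *
        ENNReal.ofReal (τ ^ (1 / r - 1)) := by
  have hn : 0 < (n : ℝ) := Nat.cast_pos.2 (Nat.pos_of_ne_zero (NeZero.ne n))
  have hr0 : 0 < r := by linarith
  have hr1 : 0 < 1 - 1 / r := by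
    rw [sub_pos, div_lt_one hr0]; exact hr
  have ha : 0 < n * (1 - 1 / r) := by positivity
  have hms : MeasurableSet {x | ENNReal.ofReal τ < roughKernel W (n / r) x ^ r} :=
    measurableSet_lt measurable_const ((measurable_roughKernel hWm _).pow_const r)
  rw [lintegral_polar _ ((measurable_roughKernel hWm _).indicator hms),
    ← lintegral_const_mul _ (by fun_prop), ← lintegral_mul_const _ (by fun_prop)]
  refine lintegral_congr fun θ => ?_
  -- The radius at which the ray through θ leaves the superlevel set.
  set u : ℝ≥0∞ := (W θ ^ r / ENNReal.ofReal τ) ^ (1 / (n : ℝ))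
  have key : ∫⁻ t in Ioi (0 : ℝ), ENNReal.ofReal (t ^ ((n : ℝ) - 1)) *
      {x | ENNReal.ofReal τ < roughKernel W (n / r) x ^ r}.indicator (roughKernel W (n / r))
        (t • (θ : EuclideanSpace ℝ (Fin n))) =
      ∫⁻ t in Ioi (0 : ℝ), W θ * {t : ℝ | ENNReal.ofReal t < u}.indicator
        (fun t => ENNReal.ofReal (t ^ (n * (1 - 1 / r) - 1))) t := by
    refine setLIntegral_congr_fun measurableSet_Ioi fun t ht => ?_
    have ht : 0 < t := ht
    simp only [indicator, mem_ofPred_eq, roughKernel_smul_sphere hW _ ht,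
      lt_mul_rpow_iff hr0 hn hτ ht]
    by_cases h : ENNReal.ofReal t < u
    · rw [if_pos h, if_pos h, mul_left_comm, ← ENNReal.ofReal_mul (by positivity),
        ← Real.rpow_add ht]
      congr 3
      field_simp
      ring
    · rw [if_neg h, if_neg h]; simp
  rw [key, lintegral_const_mul _ ?_, lintegral_rpow_indicator_lt ha]
  · have hτ' : ENNReal.ofReal τ ≠ 0 := by simpa using hτ
    have : u ^ (n * (1 - 1 / r)) = W θ ^ (r - 1) * ENNReal.ofReal (τ ^ (1 / r - 1)) := by
      simp only [u]
      rw [← ENNReal.rpow_mul, show 1 / (n : ℝ) * (n * (1 - 1 / r)) = 1 - 1 / r by field_simp,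
        ENNReal.div_rpow_of_nonneg _ _ hr1.le, ← ENNReal.rpow_mul,
        show r * (1 - 1 / r) = r - 1 by field_simp, div_eq_mul_inv, ← ENNReal.rpow_neg,
        ENNReal.ofReal_rpow_of_pos hτ, neg_sub]
    rw [this]
    have h2 : W θ * W θ ^ (r - 1) = W θ ^ r := by
      nth_rw 1 [← ENNReal.rpow_one (W θ)]
      rw [← ENNReal.rpow_add_of_nonneg _ _ zero_le_one (by linarith)]
      congr 1; ring
    rw [← h2]; ring
  · exact (by fun_prop : Measurable _).indicator
      (measurableSet_lt ENNReal.measurable_ofReal measurable_const)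

/-- The part of the kernel below a level is integrable with a large power. -/
theorem lintegral_roughKernel_le [NeZero n] {W : EuclideanSpace ℝ (Fin n) → ℝ≥0∞}
    (hWm : Measurable W) (hW : HomogZero W) {r u : ℝ} (hr : 1 < r) (hu : r < u) {τ : ℝ}
    (hτ : 0 < τ) :
    ∫⁻ x, {x | roughKernel W (n / r) x ^ r ≤ ENNReal.ofReal τ}.indicator
        (fun x => roughKernel W (n / r) x ^ u) x
      ≤ (ENNReal.ofReal (1 / (n * (u / r - 1))) *
        ∫⁻ θ : Metric.sphere (0 : EuclideanSpace ℝ (Fin n)) 1, W θ ^ r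
        ∂(volume : Measure (EuclideanSpace ℝ (Fin n))).toSphere) *
        ENNReal.ofReal (τ ^ (u / r - 1)) := by
  have hn : 0 < (n : ℝ) := Nat.cast_pos.2 (Nat.pos_of_ne_zero (NeZero.ne n))
  have hr0 : 0 < r := by linarith
  have hu0 : 0 < u := by linarith
  have hr1 : 0 < u / r - 1 := by
    rw [sub_pos, one_lt_div hr0]; exact hu
  have ha : 0 < n * (u / r - 1) := by positivity
  have hms : MeasurableSet {x | roughKernel W (n / r) x ^ r ≤ ENNReal.ofReal τ} :=
    measurableSet_le ((measurable_roughKernel hWm _).pow_const r) measurable_const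
  rw [lintegral_polar _ (((measurable_roughKernel hWm _).pow_const u).indicator hms),
    ← lintegral_const_mul _ (by fun_prop), ← lintegral_mul_const _ (by fun_prop)]
  refine lintegral_mono fun θ => ?_
  set v : ℝ≥0∞ := (W θ ^ r / ENNReal.ofReal τ) ^ (1 / (n : ℝ)) with hv
  have key : ∫⁻ t in Ioi (0 : ℝ), ENNReal.ofReal (t ^ ((n : ℝ) - 1)) *
      {x | roughKernel W (n / r) x ^ r ≤ ENNReal.ofReal τ}.indicator
        (fun x => roughKernel W (n / r) x ^ u) (t • (θ : EuclideanSpace ℝ (Fin n))) =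
      ∫⁻ t in Ioi (0 : ℝ), W θ ^ u * {t : ℝ | v ≤ ENNReal.ofReal t}.indicator
        (fun t => ENNReal.ofReal (t ^ (-(n * (u / r - 1)) - 1))) t := by
    refine setLIntegral_congr_fun measurableSet_Ioi fun t ht => ?_
    have ht : 0 < t := ht
    simp only [indicator, mem_ofPred_eq, roughKernel_smul_sphere hW _ ht, ← not_lt,
      lt_mul_rpow_iff hr0 hn hτ ht]
    by_cases h : ENNReal.ofReal t < v
    · rw [if_neg (not_not.2 h), if_neg (not_not.2 h)]; simp
    · rw [if_pos h, if_pos h, ENNReal.mul_rpow_of_nonneg _ _ hu0.le, mul_left_comm,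
        ENNReal.ofReal_rpow_of_pos (by positivity), ← Real.rpow_mul ht.le,
        ← ENNReal.ofReal_mul (by positivity), ← Real.rpow_add ht]
      congr 3
      field_simp
      ring
  rw [key, lintegral_const_mul _ ?_, lintegral_rpow_indicator_ge ha]
  · have hτ' : ENNReal.ofReal τ ≠ 0 := by simpa using hτ
    -- Since r - u < 0, the identity W^u W^{r-u} = W^r needs 0 < W < ∞. If W θ = ∞, the ray never
    -- enters the sublevel set and the left side is 0, which is why only an inequality is claimed.
    rcases eq_or_ne (W θ) 0 with h0 | h0
    · simp [h0, hu0]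
    rcases eq_or_ne (W θ) ∞ with hi | hi
    · have : v = ∞ := by
        simp [hv, hi, hr0, ENNReal.top_div, hn]
      rw [this, ENNReal.top_rpow_of_neg (by linarith)]
      simp
    have : v ^ (-(n * (u / r - 1))) = W θ ^ (r - u) * ENNReal.ofReal (τ ^ (u / r - 1)) := by
      simp only [v]
      rw [← ENNReal.rpow_mul, show 1 / (n : ℝ) * (-(n * (u / r - 1))) = -(u / r - 1) by field_simp,
        ENNReal.rpow_neg,
        ENNReal.div_rpow_of_nonneg _ _ hr1.le, ENNReal.inv_div, ← ENNReal.rpow_mul,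
        show r * (u / r - 1) = u - r by field_simp, div_eq_mul_inv, ← ENNReal.rpow_neg,
        ENNReal.ofReal_rpow_of_pos hτ, neg_sub, mul_comm]
      · left
        rw [ENNReal.ofReal_rpow_of_pos hτ]
        exact ENNReal.ofReal_ne_top
      · left
        rw [ENNReal.ofReal_rpow_of_pos hτ]
        simpa using Real.rpow_pos_of_pos hτ _
    rw [this]
    have h2 : W θ ^ u * W θ ^ (r - u) = W θ ^ r := by
      rw [← ENNReal.rpow_add _ _ h0 hi]
      congr 1; ring
    rw [← h2]
    apply le_of_eq; ring
  · exact (by fun_prop : Measurable _).indicator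
      (measurableSet_le measurable_const ENNReal.measurable_ofReal)

end

/-! ### Jensen's inequality, convolution, and layer-cake tools -/

section

/-- Jensen's inequality for a weight that need not be normalized. -/
theorem rpow_lintegral_mul_le {X : Type*} [MeasurableSpace X] {μ : Measure X} {k f : X → ℝ≥0∞}
    (hk : AEMeasurable k μ) (hf : AEMeasurable f μ) {a : ℝ} (ha : 1 ≤ a) :
    (∫⁻ x, k x * f x ∂μ) ^ a ≤ (∫⁻ x, k x ∂μ) ^ (a - 1) * ∫⁻ x, k x * f x ^ a ∂μ := by
  have ha0 : 0 < a := by linarith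
  have h1 : 0 ≤ 1 - 1 / a := by
    rw [sub_nonneg, div_le_one ha0]; exact ha
  -- Hölder applied to k f = k^{1-1/a} (k f^a)^{1/a}.
  have h := ENNReal.lintegral_mul_norm_pow_le (μ := μ) hk (hk.mul (hf.pow_const a)) h1
    (by positivity : 0 ≤ 1 / a) (by ring)
  have h2 : ∀ x, k x ^ (1 - 1 / a) * (k x * f x ^ a) ^ (1 / a) = k x * f x := fun x => by
    rw [ENNReal.mul_rpow_of_nonneg _ _ (by positivity), ← mul_assoc,
      ← ENNReal.rpow_add_of_nonneg _ _ h1 (by positivity), ← ENNReal.rpow_mul,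
      show 1 - 1 / a + 1 / a = 1 by ring, show a * (1 / a) = 1 by field_simp]
    simp
  simp only [Pi.mul_apply, h2] at h
  calc _ ≤ ((∫⁻ x, k x ∂μ) ^ (1 - 1 / a) * (∫⁻ x, k x * f x ^ a ∂μ) ^ (1 / a)) ^ a :=
        ENNReal.rpow_le_rpow h ha0.le
    _ = _ := by
        rw [ENNReal.mul_rpow_of_nonneg _ _ ha0.le, ← ENNReal.rpow_mul, ← ENNReal.rpow_mul,
          show (1 - 1 / a) * a = a - 1 by field_simp, show 1 / a * a = 1 by field_simp]
        simp

variable {n : ℕ}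

/-- The convolution of two nonnegative functions. -/
def conv (K F : EuclideanSpace ℝ (Fin n) → ℝ≥0∞) (x : EuclideanSpace ℝ (Fin n)) : ℝ≥0∞ :=
  ∫⁻ y, K (x - y) * F y

theorem measurable_conv {K F : EuclideanSpace ℝ (Fin n) → ℝ≥0∞} (hK : Measurable K)
    (hF : Measurable F) : Measurable (conv K F) :=
  Measurable.lintegral_prod_right' (f := fun z : EuclideanSpace ℝ (Fin n) ×
    EuclideanSpace ℝ (Fin n) => K (z.1 - z.2) * F z.2) (by fun_prop)

theorem conv_add_left {K K' F : EuclideanSpace ℝ (Fin n) → ℝ≥0∞} (hK : Measurable K)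
    (hF : Measurable F) (x : EuclideanSpace ℝ (Fin n)) :
    conv (fun z => K z + K' z) F x = conv K F x + conv K' F x := by
  simp only [conv, add_mul]
  exact lintegral_add_left (by fun_prop) _

theorem conv_add_right {K F F' : EuclideanSpace ℝ (Fin n) → ℝ≥0∞} (hK : Measurable K)
    (hF : Measurable F) (x : EuclideanSpace ℝ (Fin n)) :
    conv K (fun z => F z + F' z) x = conv K F x + conv K F' x := by
  simp only [conv, mul_add]
  exact lintegral_add_left (by fun_prop) _

theorem conv_const_mul_right {K F : EuclideanSpace ℝ (Fin n) → ℝ≥0∞} (hK : Measurable K)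
    (hF : Measurable F) (c : ℝ≥0∞) (x : EuclideanSpace ℝ (Fin n)) :
    conv K (fun z => c * F z) x = c * conv K F x := by
  simp only [conv, mul_left_comm _ c]
  exact lintegral_const_mul _ (by fun_prop)

theorem lintegral_conv {K F : EuclideanSpace ℝ (Fin n) → ℝ≥0∞} (hK : Measurable K)
    (hF : Measurable F) : ∫⁻ x, conv K F x = (∫⁻ x, K x) * ∫⁻ x, F x := by
  unfold conv
  rw [lintegral_lintegral_swap (by fun_prop), ← lintegral_const_mul _ hF]
  refine lintegral_congr fun y => ?_
  rw [lintegral_mul_const _ (by fun_prop), lintegral_sub_right_eq_self]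

/-- Young's inequality for a kernel in `L_1`. -/
theorem lintegral_conv_rpow_le {K F : EuclideanSpace ℝ (Fin n) → ℝ≥0∞} (hK : Measurable K)
    (hF : Measurable F) {a : ℝ} (ha : 1 ≤ a) :
    ∫⁻ x, conv K F x ^ a ≤ (∫⁻ x, K x) ^ a * ∫⁻ x, F x ^ a := by
  calc ∫⁻ x, conv K F x ^ a ≤ ∫⁻ x, (∫⁻ y, K y) ^ (a - 1) * conv K (fun y => F y ^ a) x := by
        refine lintegral_mono fun x => ?_
        have := rpow_lintegral_mul_le (μ := volume) (k := fun y => K (x - y)) (f := F)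
          (by fun_prop) (by fun_prop) ha
        rwa [lintegral_sub_left_eq_self K] at this
    _ = _ := by
        rw [lintegral_const_mul _ (measurable_conv hK (hF.pow_const a)),
          lintegral_conv hK (hF.pow_const a), ← mul_assoc]
        congr 1
        nth_rw 2 [← ENNReal.rpow_one (∫⁻ x, K x)]
        rw [← ENNReal.rpow_add_of_nonneg _ _ (by linarith) zero_le_one]
        congr 1; ring

theorem conv_le_Lp_mul_Lq {K F : EuclideanSpace ℝ (Fin n) → ℝ≥0∞} (hK : Measurable K)
    (hF : Measurable F) {p u : ℝ} (h : u.HolderConjugate p) (x : EuclideanSpace ℝ (Fin n)) :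
    conv K F x ≤ (∫⁻ y, K y ^ u) ^ (1 / u) * (∫⁻ y, F y ^ p) ^ (1 / p) := by
  have := ENNReal.lintegral_mul_le_Lp_mul_Lq volume h (f := fun y => K (x - y)) (g := F)
    (by fun_prop) (by fun_prop)
  simpa only [conv, Pi.mul_apply, lintegral_sub_left_eq_self (fun z => K z ^ u)] using this

/-- Layer cake for extended-valued functions: f(x) is the length of the interval of levels 0 < t <
f(x), infinite values included, and Tonelli does the rest. -/
theorem lintegral_eq_lintegral_meas_lt_ofReal {X : Type*} [MeasurableSpace X] {μ : Measure X}
    [SFinite μ] {f : X → ℝ≥0∞} (hf : Measurable f) :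
    ∫⁻ x, f x ∂μ = ∫⁻ t in Ioi (0 : ℝ), μ {x | ENNReal.ofReal t < f x} := by
  have h1 : ∀ x, f x = ∫⁻ t in Ioi (0 : ℝ),
      {z : X × ℝ | ENNReal.ofReal z.2 < f z.1}.indicator (fun _ => 1) (x, t) := fun x => by
    have := lintegral_rpow_indicator_lt one_pos (f x)
    simp only [div_one, ENNReal.ofReal_one, ENNReal.rpow_one, one_mul, sub_self,
      Real.rpow_zero] at this
    exact this.symm
  have hm : MeasurableSet {z : X × ℝ | ENNReal.ofReal z.2 < f z.1} :=
    measurableSet_lt (by fun_prop) (by fun_prop)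
  have hmG : Measurable ({z : X × ℝ | ENNReal.ofReal z.2 < f z.1}.indicator
      (fun _ => (1 : ℝ≥0∞))) := measurable_const.indicator hm
  calc ∫⁻ x, f x ∂μ = ∫⁻ x, (∫⁻ t in Ioi (0 : ℝ),
      {z : X × ℝ | ENNReal.ofReal z.2 < f z.1}.indicator (fun _ => 1) (x, t)) ∂μ :=
        lintegral_congr h1
    _ = _ := by
        refine (lintegral_lintegral_swap (f := fun x t =>
          {z : X × ℝ | ENNReal.ofReal z.2 < f z.1}.indicator (fun _ => 1) (x, t))
          hmG.aemeasurable).trans (lintegral_congr fun t => ?_)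
        have : MeasurableSet {x | ENNReal.ofReal t < f x} :=
          measurableSet_lt (by fun_prop) (by fun_prop)
        rw [← lintegral_indicator_one this]
        rfl

theorem meas_lt_le_mul_lintegral_rpow {X : Type*} [MeasurableSpace X] {μ : Measure X}
    {f : X → ℝ≥0∞} (hf : Measurable f) {a v : ℝ} (ha : 0 < a) (hv : 0 < v) :
    μ {x | ENNReal.ofReal v < f x} ≤ ENNReal.ofReal (v ^ (-a)) * ∫⁻ x, f x ^ a ∂μ := by
  have h1 := mul_meas_ge_le_lintegral (μ := μ) (hf.pow_const a) (ENNReal.ofReal (v ^ a))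
  have h2 : μ {x | ENNReal.ofReal v < f x} ≤ μ {x | ENNReal.ofReal (v ^ a) ≤ f x ^ a} := by
    refine measure_mono fun x hx => ?_
    simp only [mem_ofPred_eq] at hx ⊢
    rw [← ENNReal.ofReal_rpow_of_pos hv]
    exact ENNReal.rpow_le_rpow hx.le ha.le
  calc _ ≤ ENNReal.ofReal (v ^ (-a)) * (ENNReal.ofReal (v ^ a) *
        μ {x | ENNReal.ofReal (v ^ a) ≤ f x ^ a}) := by
        rw [← mul_assoc, ← ENNReal.ofReal_mul (by positivity), ← Real.rpow_add hv]
        simpa using h2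
    _ ≤ _ := by gcongr

theorem indicator_lt_add_indicator_le {X : Type*} (f g : X → ℝ≥0∞) (c : ℝ≥0∞) (x : X) :
    g x = {x | c < f x}.indicator g x + {x | f x ≤ c}.indicator g x := by
  by_cases h : c < f x
  · simp [indicator, h, not_le.2 h]
  · simp [indicator, h, not_lt.1 h]

/-! ### The weak Young inequality -/

section WeakYoung

variable {K F : EuclideanSpace ℝ (Fin n) → ℝ≥0∞} {p q r u : ℝ} {C₀ C₁ : ℝ≥0∞}

/-- The level set estimate behind the weak Young inequality. -/
theorem meas_conv_lt_le (hKm : Measurable K) (hFm : Measurable F) (hp : 1 < p) (hr : 0 < r)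
    (hpqr : 1 / p + 1 / r = 1 + 1 / q) (hu : u.HolderConjugate p)
    (hK₁ : ∀ τ : ℝ, 0 < τ → ∫⁻ x, {x | ENNReal.ofReal τ < K x ^ r}.indicator K x ≤
      C₀ * ENNReal.ofReal (τ ^ (1 / r - 1)))
    (hK₂ : ∀ τ : ℝ, 0 < τ → ∫⁻ x, {x | K x ^ r ≤ ENNReal.ofReal τ}.indicator
      (fun x => K x ^ u) x ≤ C₁ * ENNReal.ofReal (τ ^ (u / r - 1)))
    (hF : ∫⁻ x, F x ^ p = 1) {τ : ℝ} (hτ : 0 < τ) :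
    volume {x | (C₁ ^ (1 / u) + 2) * ENNReal.ofReal (τ ^ (1 / q)) < conv K F x} ≤
      C₀ * (ENNReal.ofReal (τ ^ (-(1 / p))) *
        ∫⁻ y, {y | ENNReal.ofReal τ < F y ^ p}.indicator F y) +
      C₀ ^ (2 * p) * (ENNReal.ofReal (τ ^ (-2 : ℝ)) *
        ∫⁻ y, {y | F y ^ p ≤ ENNReal.ofReal τ}.indicator (fun y => F y ^ (2 * p)) y) := by
  have hp0 : 0 < p := by linarith
  have hu0 : 0 < u := hu.pos
  have hsK₁ : MeasurableSet {x | ENNReal.ofReal τ < K x ^ r} :=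
    measurableSet_lt measurable_const (hKm.pow_const r)
  have hsK₂ : MeasurableSet {x | K x ^ r ≤ ENNReal.ofReal τ} :=
    measurableSet_le (hKm.pow_const r) measurable_const
  have hsF₁ : MeasurableSet {x | ENNReal.ofReal τ < F x ^ p} :=
    measurableSet_lt measurable_const (hFm.pow_const p)
  have hsF₂ : MeasurableSet {x | F x ^ p ≤ ENNReal.ofReal τ} :=
    measurableSet_le (hFm.pow_const p) measurable_const
  -- Kernel and function are truncated at the common scale τ, through K^r and F^p. With ∫ F^p = 1
  -- and the relation between p, q and r, every piece then matches the height τ^{1/q}.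
  set K₁ := {x | ENNReal.ofReal τ < K x ^ r}.indicator K with hK₁_def
  set K₂ := {x | K x ^ r ≤ ENNReal.ofReal τ}.indicator K with hK₂_def
  set F₁ := {x | ENNReal.ofReal τ < F x ^ p}.indicator F with hF₁_def
  set F₂ := {x | F x ^ p ≤ ENNReal.ofReal τ}.indicator F with hF₂_def
  have hK₁m : Measurable K₁ := hKm.indicator hsK₁
  have hK₂m : Measurable K₂ := hKm.indicator hsK₂
  have hF₁m : Measurable F₁ := hFm.indicator hsF₁
  have hF₂m : Measurable F₂ := hFm.indicator hsF₂
  have hsplit : ∀ x, conv K F x = conv K₁ F₁ x + conv K₁ F₂ x + conv K₂ F x := fun x => by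
    rw [← conv_add_right hK₁m hF₁m]
    have e1 : (fun z => F₁ z + F₂ z) = F :=
      funext fun z => (indicator_lt_add_indicator_le (fun z => F z ^ p) F _ z).symm
    rw [e1, ← conv_add_left hK₁m hFm]
    have e2 : (fun z => K₁ z + K₂ z) = K :=
      funext fun z => (indicator_lt_add_indicator_le (fun z => K z ^ r) K _ z).symm
    rw [e2]
  -- The low part of the kernel is handled by Hölder against ‖F‖_p = 1; the exponents match because
  -- (u/r - 1)/u = 1/r - 1/u = 1/q.
  have hbdd : ∀ x, conv K₂ F x ≤ C₁ ^ (1 / u) * ENNReal.ofReal (τ ^ (1 / q)) := fun x => by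
    refine (conv_le_Lp_mul_Lq hK₂m hFm hu x).trans ?_
    rw [hF, ENNReal.one_rpow, mul_one]
    have e : (fun y => K₂ y ^ u) = {x | K x ^ r ≤ ENNReal.ofReal τ}.indicator
        (fun x => K x ^ u) := by
      ext y
      by_cases h : K y ^ r ≤ ENNReal.ofReal τ <;> simp [hK₂_def, indicator, h, hu0]
    rw [e]
    refine (ENNReal.rpow_le_rpow (hK₂ τ hτ) (by positivity)).trans ?_
    rw [ENNReal.mul_rpow_of_nonneg _ _ (by positivity), ENNReal.ofReal_rpow_of_pos (by positivity),
      ← Real.rpow_mul hτ.le]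
    have e3 : (u / r - 1) * (1 / u) = 1 / q := by
      have := hu.inv_add_inv_eq_one
      simp only [← one_div] at this
      have : (u / r - 1) * (1 / u) = 1 / r - 1 / u := by field_simp
      linarith
    rw [e3]
  -- The low kernel part uses up C₁^{1/u} τ^{1/q} everywhere, so one of the other two pieces must
  -- exceed half of the remaining 2 τ^{1/q}.
  have hsub : {x | (C₁ ^ (1 / u) + 2) * ENNReal.ofReal (τ ^ (1 / q)) < conv K F x} ⊆
      {x | ENNReal.ofReal (τ ^ (1 / q)) < conv K₁ F₁ x} ∪
        {x | ENNReal.ofReal (τ ^ (1 / q)) < conv K₁ F₂ x} := by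
    intro x hx
    by_contra hcon
    simp only [mem_union, mem_ofPred_eq, not_or, not_lt] at hcon hx
    refine absurd hx (not_lt.2 ?_)
    rw [hsplit, add_mul, two_mul, add_comm (C₁ ^ (1 / u) * _)]
    exact add_le_add (add_le_add hcon.1 hcon.2) (hbdd x)
  have hτq : 0 < τ ^ (1 / q) := by positivity
  refine (measure_mono hsub).trans ((measure_union_le _ _).trans (add_le_add ?_ ?_))
  · refine (meas_lt_le_mul_lintegral_rpow (measurable_conv hK₁m hF₁m) one_pos hτq).trans ?_
    simp only [ENNReal.rpow_one]
    rw [lintegral_conv hK₁m hF₁m]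
    calc _ ≤ ENNReal.ofReal ((τ ^ (1 / q)) ^ (-1 : ℝ)) *
          ((C₀ * ENNReal.ofReal (τ ^ (1 / r - 1))) * ∫⁻ x, F₁ x) := by
          gcongr
          exact hK₁ τ hτ
      _ = C₀ * ((ENNReal.ofReal ((τ ^ (1 / q)) ^ (-1 : ℝ)) * ENNReal.ofReal (τ ^ (1 / r - 1))) *
          ∫⁻ x, F₁ x) := by ring
      _ = _ := by
          rw [← ENNReal.ofReal_mul (by positivity), ← Real.rpow_mul hτ.le, ← Real.rpow_add hτ,
            show 1 / q * -1 + (1 / r - 1) = -(1 / p) by linarith]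
  -- The low part of F admits powers above p. The choice 2p makes the power of τ equal to -2, which
  -- is integrable at infinity.
  · have h2p : 1 ≤ 2 * p := by linarith
    refine (meas_lt_le_mul_lintegral_rpow (measurable_conv hK₁m hF₂m)
      (by linarith : 0 < 2 * p) hτq).trans ?_
    have e : (fun y => F₂ y ^ (2 * p)) = {x | F x ^ p ≤ ENNReal.ofReal τ}.indicator
        (fun x => F x ^ (2 * p)) := by
      ext y
      by_cases h : F y ^ p ≤ ENNReal.ofReal τ <;> simp [hF₂_def, indicator, h, hp0]
    rw [← e]
    calc _ ≤ ENNReal.ofReal ((τ ^ (1 / q)) ^ (-(2 * p))) *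
          ((C₀ * ENNReal.ofReal (τ ^ (1 / r - 1))) ^ (2 * p) * ∫⁻ x, F₂ x ^ (2 * p)) := by
          gcongr
          refine (lintegral_conv_rpow_le hK₁m hF₂m h2p).trans ?_
          gcongr
          exact hK₁ τ hτ
      _ = C₀ ^ (2 * p) * ((ENNReal.ofReal ((τ ^ (1 / q)) ^ (-(2 * p))) *
          ENNReal.ofReal ((τ ^ (1 / r - 1)) ^ (2 * p))) * ∫⁻ x, F₂ x ^ (2 * p)) := by
          rw [ENNReal.mul_rpow_of_nonneg _ _ (by linarith),
            ENNReal.ofReal_rpow_of_pos (by positivity)]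
          ring
      _ = _ := by
          rw [← ENNReal.ofReal_mul (by positivity), ← Real.rpow_mul hτ.le, ← Real.rpow_mul hτ.le,
            ← Real.rpow_add hτ]
          have : 1 / q * -(2 * p) + (1 / r - 1) * (2 * p) = -2 := by
            have : 1 / q * -(2 * p) + (1 / r - 1) * (2 * p) = (1 / r - 1 - 1 / q) * (2 * p) := by
              ring
            rw [this, show 1 / r - 1 - 1 / q = -(1 / p) by linarith]
            field_simp
          rw [this]

/-- By Tonelli, τ runs over 0 < τ < F(y)^p for fixed y. There τ^{-1/p} is integrable because p > 1,
and contributes p' F(y)^{p-1}. -/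
theorem lintegral_level_gt (hFm : Measurable F) (hp : 1 < p) :
    ∫⁻ τ in Ioi (0 : ℝ), ENNReal.ofReal (τ ^ (-(1 / p))) *
        ∫⁻ y, {y | ENNReal.ofReal τ < F y ^ p}.indicator F y =
      ENNReal.ofReal (1 / (1 - 1 / p)) * ∫⁻ y, F y ^ p := by
  have hp0 : 0 < p := by linarith
  have hp1 : 0 < 1 - 1 / p := by
    rw [sub_pos, div_lt_one hp0]; exact hp
  have hm : MeasurableSet {z : ℝ × EuclideanSpace ℝ (Fin n) | ENNReal.ofReal z.1 < F z.2 ^ p} :=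
    measurableSet_lt (by fun_prop) (by fun_prop)
  have hmG : Measurable ({z : ℝ × EuclideanSpace ℝ (Fin n) |
      ENNReal.ofReal z.1 < F z.2 ^ p}.indicator
      (fun z => ENNReal.ofReal (z.1 ^ (-(1 / p))) * F z.2)) :=
    Measurable.indicator (by fun_prop) hm
  calc _ = ∫⁻ τ in Ioi (0 : ℝ), ∫⁻ y, {z : ℝ × EuclideanSpace ℝ (Fin n) |
        ENNReal.ofReal z.1 < F z.2 ^ p}.indicator
        (fun z => ENNReal.ofReal (z.1 ^ (-(1 / p))) * F z.2) (τ, y) := by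
        refine lintegral_congr fun τ => ?_
        rw [← lintegral_const_mul _ (hFm.indicator
          (measurableSet_lt measurable_const (hFm.pow_const p)))]
        refine lintegral_congr fun y => ?_
        by_cases h : ENNReal.ofReal τ < F y ^ p <;> simp [indicator, h]
    _ = ∫⁻ y, ∫⁻ τ in Ioi (0 : ℝ), {z : ℝ × EuclideanSpace ℝ (Fin n) |
        ENNReal.ofReal z.1 < F z.2 ^ p}.indicator
        (fun z => ENNReal.ofReal (z.1 ^ (-(1 / p))) * F z.2) (τ, y) :=
        lintegral_lintegral_swap hmG.aemeasurable
    _ = _ := by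
        rw [← lintegral_const_mul _ (hFm.pow_const p)]
        refine lintegral_congr fun y => ?_
        have h1 : ∀ τ, {z : ℝ × EuclideanSpace ℝ (Fin n) |
            ENNReal.ofReal z.1 < F z.2 ^ p}.indicator
            (fun z => ENNReal.ofReal (z.1 ^ (-(1 / p))) * F z.2) (τ, y) =
            F y * {t : ℝ | ENNReal.ofReal t < F y ^ p}.indicator
              (fun t => ENNReal.ofReal (t ^ ((1 - 1 / p) - 1))) τ := fun τ => by
          rw [show 1 - 1 / p - 1 = -(1 / p) by ring]
          by_cases h : ENNReal.ofReal τ < F y ^ p <;> simp [indicator, h, mul_comm]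
        simp only [h1]
        rw [lintegral_const_mul _ (Measurable.indicator (by fun_prop)
          (measurableSet_lt ENNReal.measurable_ofReal measurable_const)),
          lintegral_rpow_indicator_lt hp1, mul_left_comm, ← ENNReal.rpow_mul]
        congr 1
        nth_rw 1 [← ENNReal.rpow_one (F y)]
        rw [← ENNReal.rpow_add_of_nonneg _ _ zero_le_one (by positivity)]
        congr 1
        field_simp
        ring

/-- By Tonelli, τ runs over τ ≥ F(y)^p, where τ^{-2} integrates to F(y)^{-p}. Points with F(y) = ∞
contribute 0 on the left, hence an inequality. -/
theorem lintegral_level_le (hFm : Measurable F) (hp : 1 < p) :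
    ∫⁻ τ in Ioi (0 : ℝ), ENNReal.ofReal (τ ^ (-2 : ℝ)) *
        ∫⁻ y, {y | F y ^ p ≤ ENNReal.ofReal τ}.indicator (fun y => F y ^ (2 * p)) y ≤
      ∫⁻ y, F y ^ p := by
  have hp0 : 0 < p := by linarith
  have hm : MeasurableSet {z : ℝ × EuclideanSpace ℝ (Fin n) | F z.2 ^ p ≤ ENNReal.ofReal z.1} :=
    measurableSet_le (by fun_prop) (by fun_prop)
  have hmG : Measurable ({z : ℝ × EuclideanSpace ℝ (Fin n) |
      F z.2 ^ p ≤ ENNReal.ofReal z.1}.indicator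
      (fun z => ENNReal.ofReal (z.1 ^ (-2 : ℝ)) * F z.2 ^ (2 * p))) :=
    Measurable.indicator (by fun_prop) hm
  calc _ = ∫⁻ τ in Ioi (0 : ℝ), ∫⁻ y, {z : ℝ × EuclideanSpace ℝ (Fin n) |
        F z.2 ^ p ≤ ENNReal.ofReal z.1}.indicator
        (fun z => ENNReal.ofReal (z.1 ^ (-2 : ℝ)) * F z.2 ^ (2 * p)) (τ, y) := by
        refine lintegral_congr fun τ => ?_
        rw [← lintegral_const_mul _ ((hFm.pow_const _).indicator
          (measurableSet_le (hFm.pow_const p) measurable_const))]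
        refine lintegral_congr fun y => ?_
        by_cases h : F y ^ p ≤ ENNReal.ofReal τ <;> simp [indicator, h]
    _ = ∫⁻ y, ∫⁻ τ in Ioi (0 : ℝ), {z : ℝ × EuclideanSpace ℝ (Fin n) |
        F z.2 ^ p ≤ ENNReal.ofReal z.1}.indicator
        (fun z => ENNReal.ofReal (z.1 ^ (-2 : ℝ)) * F z.2 ^ (2 * p)) (τ, y) :=
        lintegral_lintegral_swap hmG.aemeasurable
    _ ≤ _ := by
        refine lintegral_mono fun y => ?_
        have h1 : ∀ τ, {z : ℝ × EuclideanSpace ℝ (Fin n) |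
            F z.2 ^ p ≤ ENNReal.ofReal z.1}.indicator
            (fun z => ENNReal.ofReal (z.1 ^ (-2 : ℝ)) * F z.2 ^ (2 * p)) (τ, y) =
            F y ^ (2 * p) * {t : ℝ | F y ^ p ≤ ENNReal.ofReal t}.indicator
              (fun t => ENNReal.ofReal (t ^ (-1 - 1 : ℝ))) τ := fun τ => by
          rw [show (-1 - 1 : ℝ) = -2 by norm_num]
          by_cases h : F y ^ p ≤ ENNReal.ofReal τ <;> simp [indicator, h, mul_comm]
        simp only [h1]
        rw [lintegral_const_mul _ (Measurable.indicator (by fun_prop)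
          (measurableSet_le measurable_const ENNReal.measurable_ofReal)),
          lintegral_rpow_indicator_ge one_pos, ← ENNReal.rpow_mul]
        rcases eq_or_ne (F y) 0 with h0 | h0
        · simp [h0, hp0]
        rcases eq_or_ne (F y) ∞ with hi | hi
        · simp [hi, hp0]
        · rw [mul_left_comm, ← ENNReal.rpow_add _ _ h0 hi]
          rw [show 2 * p + p * -1 = p by ring]
          simp

theorem measurable_level_gt (hFm : Measurable F) (p : ℝ) :
    Measurable fun τ : ℝ => ENNReal.ofReal (τ ^ (-(1 / p))) *
      ∫⁻ y, {y | ENNReal.ofReal τ < F y ^ p}.indicator F y := by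
  refine Measurable.mul (by fun_prop) ?_
  exact Measurable.lintegral_prod_right' (f := {z : ℝ × EuclideanSpace ℝ (Fin n) |
    ENNReal.ofReal z.1 < F z.2 ^ p}.indicator (fun z => F z.2))
    (Measurable.indicator (by fun_prop) (measurableSet_lt (by fun_prop) (by fun_prop)))

theorem measurable_level_le (hFm : Measurable F) (p : ℝ) :
    Measurable fun τ : ℝ => ENNReal.ofReal (τ ^ (-2 : ℝ)) *
      ∫⁻ y, {y | F y ^ p ≤ ENNReal.ofReal τ}.indicator (fun y => F y ^ (2 * p)) y := by
  refine Measurable.mul (by fun_prop) ?_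
  exact Measurable.lintegral_prod_right' (f := {z : ℝ × EuclideanSpace ℝ (Fin n) |
    F z.2 ^ p ≤ ENNReal.ofReal z.1}.indicator (fun z => F z.2 ^ (2 * p)))
    (Measurable.indicator (by fun_prop) (measurableSet_le (by fun_prop) (by fun_prop)))

/-- The weak Young inequality, for a normalized function. -/
theorem lintegral_conv_rpow_le_of_normalized (hKm : Measurable K) (hFm : Measurable F)
    (hp : 1 < p) (hr : 0 < r)
    (hq : 0 < q) (hpqr : 1 / p + 1 / r = 1 + 1 / q) (hu : u.HolderConjugate p) (hC₁ : C₁ ≠ ∞)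
    (hK₁ : ∀ τ : ℝ, 0 < τ → ∫⁻ x, {x | ENNReal.ofReal τ < K x ^ r}.indicator K x ≤
      C₀ * ENNReal.ofReal (τ ^ (1 / r - 1)))
    (hK₂ : ∀ τ : ℝ, 0 < τ → ∫⁻ x, {x | K x ^ r ≤ ENNReal.ofReal τ}.indicator
      (fun x => K x ^ u) x ≤ C₁ * ENNReal.ofReal (τ ^ (u / r - 1)))
    (hF : ∫⁻ x, F x ^ p = 1) :
    ∫⁻ x, conv K F x ^ q ≤ (C₁ ^ (1 / u) + 2) ^ q *
      (C₀ * ENNReal.ofReal (1 / (1 - 1 / p)) + C₀ ^ (2 * p)) := by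
  set c := C₁ ^ (1 / u) + 2
  have hu0 : 0 < u := hu.pos
  have hc : c ≠ ∞ := by
    refine ENNReal.add_ne_top.2 ⟨ENNReal.rpow_ne_top_of_nonneg (by positivity) hC₁, by simp⟩
  have hc0 : c ≠ 0 := by simp [c]
  have hcq0 : c ^ q ≠ 0 := by simp [hc0, hc]
  have hcq : c ^ q ≠ ∞ := ENNReal.rpow_ne_top_of_nonneg hq.le hc
  have hmc := measurable_conv hKm hFm
  calc ∫⁻ x, conv K F x ^ q = c ^ q * ∫⁻ x, conv K F x ^ q / c ^ q := by
        simp only [div_eq_mul_inv]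
        rw [lintegral_mul_const _ (hmc.pow_const q), mul_comm, mul_assoc,
          ENNReal.inv_mul_cancel hcq0 hcq, mul_one]
    _ ≤ _ := ?_
  gcongr
  -- Layer cake for (H/c)^q with H the convolution: the level τ corresponds to H > c τ^{1/q}, the
  -- set measured in `meas_conv_lt_le`.
  rw [lintegral_eq_lintegral_meas_lt_ofReal (by fun_prop)]
  calc _ ≤ ∫⁻ τ in Ioi (0 : ℝ), (C₀ * (ENNReal.ofReal (τ ^ (-(1 / p))) *
        ∫⁻ y, {y | ENNReal.ofReal τ < F y ^ p}.indicator F y) +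
      C₀ ^ (2 * p) * (ENNReal.ofReal (τ ^ (-2 : ℝ)) *
        ∫⁻ y, {y | F y ^ p ≤ ENNReal.ofReal τ}.indicator (fun y => F y ^ (2 * p)) y)) := by
        refine setLIntegral_mono' measurableSet_Ioi fun τ hτ => ?_
        refine le_trans (measure_mono fun x hx => ?_)
          (meas_conv_lt_le hKm hFm hp hr hpqr hu hK₁ hK₂ hF hτ)
        simp only [mem_ofPred_eq] at hx ⊢
        rw [← ENNReal.div_rpow_of_nonneg _ _ hq.le] at hx
        have hx2 := ENNReal.rpow_lt_rpow hx (by positivity : 0 < 1 / q)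
        rw [← ENNReal.rpow_mul, show q * (1 / q) = 1 by field_simp, ENNReal.rpow_one,
          ENNReal.ofReal_rpow_of_pos hτ, ENNReal.lt_div_iff_mul_lt (Or.inl hc0) (Or.inl hc)] at hx2
        rwa [mul_comm]
    _ = C₀ * (∫⁻ τ in Ioi (0 : ℝ), ENNReal.ofReal (τ ^ (-(1 / p))) *
          ∫⁻ y, {y | ENNReal.ofReal τ < F y ^ p}.indicator F y) +
        C₀ ^ (2 * p) * (∫⁻ τ in Ioi (0 : ℝ), ENNReal.ofReal (τ ^ (-2 : ℝ)) *
        ∫⁻ y, {y | F y ^ p ≤ ENNReal.ofReal τ}.indicator (fun y => F y ^ (2 * p)) y) := by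
        have hm₁ := measurable_level_gt hFm p
        have hm₂ := measurable_level_le hFm p
        rw [lintegral_add_left (hm₁.const_mul _), lintegral_const_mul _ hm₁,
          lintegral_const_mul _ hm₂]
    _ ≤ _ := by
        rw [lintegral_level_gt hFm hp, hF, mul_one]
        gcongr
        refine (mul_le_mul_right ((lintegral_level_le hFm hp).trans_eq hF) _).trans ?_
        rw [mul_one]

/-- The weak Young inequality. -/
theorem exists_lintegral_conv_rpow_le (hKm : Measurable K) (hp : 1 < p) (hr : 0 < r)
    (hq : 0 < q) (hpqr : 1 / p + 1 / r = 1 + 1 / q) (hu : u.HolderConjugate p)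
    (hC₀ : C₀ ≠ ∞) (hC₁ : C₁ ≠ ∞)
    (hK₁ : ∀ τ : ℝ, 0 < τ → ∫⁻ x, {x | ENNReal.ofReal τ < K x ^ r}.indicator K x ≤
      C₀ * ENNReal.ofReal (τ ^ (1 / r - 1)))
    (hK₂ : ∀ τ : ℝ, 0 < τ → ∫⁻ x, {x | K x ^ r ≤ ENNReal.ofReal τ}.indicator
      (fun x => K x ^ u) x ≤ C₁ * ENNReal.ofReal (τ ^ (u / r - 1))) :
    ∃ C : ℝ≥0, ∀ F : EuclideanSpace ℝ (Fin n) → ℝ≥0∞, Measurable F →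
      (∫⁻ x, conv K F x ^ q) ^ (1 / q) ≤ C * (∫⁻ x, F x ^ p) ^ (1 / p) := by
  have hp0 : 0 < p := by linarith
  set A : ℝ≥0∞ := (C₁ ^ (1 / u) + 2) ^ q *
      (C₀ * ENNReal.ofReal (1 / (1 - 1 / p)) + C₀ ^ (2 * p)) with hA
  have hu0 : 0 < u := hu.pos
  have hAt : A ≠ ∞ := by
    refine ENNReal.mul_ne_top (ENNReal.rpow_ne_top_of_nonneg hq.le (ENNReal.add_ne_top.2
      ⟨ENNReal.rpow_ne_top_of_nonneg (by positivity) hC₁, by simp⟩)) (ENNReal.add_ne_top.2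
      ⟨ENNReal.mul_ne_top hC₀ ENNReal.ofReal_ne_top,
        ENNReal.rpow_ne_top_of_nonneg (by positivity) hC₀⟩)
  have hAq : A ^ (1 / q) ≠ ∞ := ENNReal.rpow_ne_top_of_nonneg (by positivity) hAt
  -- Adding 1 keeps the constant nonzero, so that the right side is infinite when ‖F‖_p = ∞.
  refine ⟨(A ^ (1 / q)).toNNReal + 1, fun F hFm => ?_⟩
  set N := (∫⁻ x, F x ^ p) ^ (1 / p) with hN
  have hNp : N ^ p = ∫⁻ x, F x ^ p := by
    rw [hN, ← ENNReal.rpow_mul, show 1 / p * p = 1 by field_simp, ENNReal.rpow_one]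
  rcases eq_or_ne N ∞ with hNi | hNi
  · rw [hNi, ENNReal.mul_top (by simp)]
    exact le_top
  rcases eq_or_ne N 0 with hN0 | hN0
  · have h0 : ∫⁻ x, F x ^ p = 0 := by rw [← hNp, hN0, ENNReal.zero_rpow_of_pos hp0]
    rw [lintegral_eq_zero_iff (hFm.pow_const p)] at h0
    have hF0 : ∀ᵐ x, F x = 0 := by
      filter_upwards [h0] with x hx
      simpa [hp0, hp0.not_gt] using hx
    have : ∀ x, conv K F x = 0 := fun x => by
      rw [conv, lintegral_eq_zero_iff (by fun_prop)]
      filter_upwards [hF0] with y hy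
      simp [hy]
    simp [this, hq]
  -- With 0 < N < ∞, homogeneity reduces the claim to the normalized function F/N.
  have hF'm : Measurable fun x => N⁻¹ * F x := by fun_prop
  have hnorm : ∫⁻ x, (N⁻¹ * F x) ^ p = 1 := by
    simp only [ENNReal.mul_rpow_of_nonneg _ _ hp0.le]
    rw [lintegral_const_mul _ (hFm.pow_const p), ← hNp, ← ENNReal.mul_rpow_of_nonneg _ _ hp0.le,
      ENNReal.inv_mul_cancel hN0 hNi, ENNReal.one_rpow]
  have h := lintegral_conv_rpow_le_of_normalized hKm hF'm hp hr hq hpqr hu hC₁ hK₁ hK₂ hnorm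
  simp only [conv_const_mul_right hKm hFm, ENNReal.mul_rpow_of_nonneg _ _ hq.le] at h
  rw [lintegral_const_mul _ ((measurable_conv hKm hFm).pow_const q)] at h
  have h2 := ENNReal.rpow_le_rpow h (by positivity : 0 ≤ 1 / q)
  rw [ENNReal.mul_rpow_of_nonneg _ _ (by positivity), ← ENNReal.rpow_mul,
    show q * (1 / q) = 1 by field_simp, ENNReal.rpow_one, ← hA] at h2
  calc (∫⁻ x, conv K F x ^ q) ^ (1 / q) = N * (N⁻¹ * (∫⁻ x, conv K F x ^ q) ^ (1 / q)) := by
        rw [← mul_assoc, ENNReal.mul_inv_cancel hN0 hNi, one_mul]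
    _ ≤ N * A ^ (1 / q) := by gcongr
    _ ≤ _ := by
        rw [mul_comm]
        gcongr
        rw [ENNReal.coe_add, ENNReal.coe_toNNReal hAq]
        exact le_self_add

end WeakYoung

end

/-! ### Norms over balls and the far part of the convolution -/

section

variable {n : ℕ}

theorem volume_ball_eq [NeZero n] (x : EuclideanSpace ℝ (Fin n)) {t : ℝ} (ht : 0 < t) :
    volume (Metric.ball x t) = ENNReal.ofReal (t ^ (n : ℝ)) *
      volume (Metric.ball (0 : EuclideanSpace ℝ (Fin n)) 1) := by
  rw [Measure.addHaar_ball _ x ht.le, finrank_euclideanSpace_fin, Real.rpow_natCast]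

/-- `‖F‖_{L_p(B(x, t))}`. -/
def ballNorm (p : ℝ) (F : EuclideanSpace ℝ (Fin n) → ℝ≥0∞) (x : EuclideanSpace ℝ (Fin n))
    (t : ℝ) : ℝ≥0∞ :=
  (∫⁻ y in Metric.ball x t, F y ^ p) ^ (1 / p)

theorem ballNorm_mono {p : ℝ} (hp : 0 < p) (F : EuclideanSpace ℝ (Fin n) → ℝ≥0∞)
    (x : EuclideanSpace ℝ (Fin n)) : Monotone (ballNorm p F x) := fun _ _ h =>
  ENNReal.rpow_le_rpow (lintegral_mono_set (Metric.ball_subset_ball h)) (by positivity)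

theorem ballNorm_mono_fun {p : ℝ} (hp : 0 < p) {F G : EuclideanSpace ℝ (Fin n) → ℝ≥0∞}
    (h : ∀ y, F y ≤ G y) (x : EuclideanSpace ℝ (Fin n)) (t : ℝ) :
    ballNorm p F x t ≤ ballNorm p G x t :=
  ENNReal.rpow_le_rpow (lintegral_mono fun y => ENNReal.rpow_le_rpow (h y) hp.le) (by positivity)

theorem ballNorm_add_le {p : ℝ} (hp : 1 ≤ p) {F G : EuclideanSpace ℝ (Fin n) → ℝ≥0∞}
    (hF : Measurable F) (hG : Measurable G) (x : EuclideanSpace ℝ (Fin n)) (t : ℝ) :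
    ballNorm p (fun y => F y + G y) x t ≤ ballNorm p F x t + ballNorm p G x t :=
  ENNReal.lintegral_Lp_add_le hF.aemeasurable hG.aemeasurable hp

theorem ballNorm_le_of_forall_le [NeZero n] {q : ℝ} (hq : 0 < q)
    {G : EuclideanSpace ℝ (Fin n) → ℝ≥0∞} {c : ℝ≥0∞} {x : EuclideanSpace ℝ (Fin n)} {t : ℝ}
    (ht : 0 < t) (h : ∀ y ∈ Metric.ball x t, G y ≤ c) :
    ballNorm q G x t ≤ volume (Metric.ball (0 : EuclideanSpace ℝ (Fin n)) 1) ^ (1 / q) *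
      ENNReal.ofReal (t ^ (n / q)) * c := by
  calc ballNorm q G x t ≤ (∫⁻ _ in Metric.ball x t, c ^ q) ^ (1 / q) := by
        refine ENNReal.rpow_le_rpow ?_ (by positivity)
        exact setLIntegral_mono' Metric.isOpen_ball.measurableSet
          fun y hy => ENNReal.rpow_le_rpow (h y hy) hq.le
    _ = _ := by
        rw [setLIntegral_const, volume_ball_eq x ht, ENNReal.mul_rpow_of_nonneg _ _ (by positivity),
          ENNReal.mul_rpow_of_nonneg _ _ (by positivity), ← ENNReal.rpow_mul,
          ENNReal.ofReal_rpow_of_pos (by positivity), ← Real.rpow_mul ht.le,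
          show q * (1 / q) = 1 by field_simp, ENNReal.rpow_one, mul_one_div]
        ring

/-- Hölder's inequality on a ball, against a constant. -/
theorem setLIntegral_ball_le [NeZero n] {p u : ℝ} (hu : u.HolderConjugate p)
    {F : EuclideanSpace ℝ (Fin n) → ℝ≥0∞} (hF : Measurable F) (x : EuclideanSpace ℝ (Fin n))
    {t : ℝ} (ht : 0 < t) :
    ∫⁻ y in Metric.ball x t, F y ≤
      volume (Metric.ball (0 : EuclideanSpace ℝ (Fin n)) 1) ^ (1 / u) *
      ENNReal.ofReal (t ^ (n / u)) * ballNorm p F x t := by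
  have hu0 := hu.pos
  have h := ENNReal.lintegral_mul_le_Lp_mul_Lq (volume.restrict (Metric.ball x t)) hu
    (f := fun _ => 1) (g := F) (by fun_prop) (by fun_prop)
  simp only [Pi.mul_apply, one_mul, ENNReal.one_rpow, setLIntegral_const] at h
  rw [volume_ball_eq x ht, ENNReal.mul_rpow_of_nonneg _ _ (by positivity),
    ENNReal.ofReal_rpow_of_pos (by positivity), ← Real.rpow_mul ht.le, mul_one_div] at h
  rwa [mul_comm (volume _ ^ (1 / u))]

/-- Integration of a radial weight over the complement of a ball, by layers. -/
theorem lintegral_compl_ball_le {γ R : ℝ} (hγ : 0 < γ) (hR : 0 < R)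
    {H : EuclideanSpace ℝ (Fin n) → ℝ≥0∞} (hH : Measurable H) (x : EuclideanSpace ℝ (Fin n)) :
    ∫⁻ y in (Metric.ball x R)ᶜ, ENNReal.ofReal (‖x - y‖ ^ (-γ)) * H y ≤
      ENNReal.ofReal γ * ∫⁻ t in Ioi R, ENNReal.ofReal (t ^ (-γ - 1)) *
        ∫⁻ y in Metric.ball x t, H y := by
  set S : Set (EuclideanSpace ℝ (Fin n) × ℝ) := {z | ‖x - z.1‖ < z.2} with hS
  have hSm : MeasurableSet S := measurableSet_lt (by fun_prop) (by fun_prop)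
  set G : EuclideanSpace ℝ (Fin n) × ℝ → ℝ≥0∞ :=
    S.indicator (fun z => ENNReal.ofReal (z.2 ^ (-γ - 1)) * H z.1) with hG
  have hGm : Measurable G := Measurable.indicator (by fun_prop) hSm
  have hB : MeasurableSet (Metric.ball x R)ᶜ := Metric.isOpen_ball.measurableSet.compl
  calc _ ≤ ∫⁻ y in (Metric.ball x R)ᶜ, ENNReal.ofReal γ * ∫⁻ t in Ioi R, G (y, t) := by
        refine setLIntegral_mono' hB fun y hy => ?_
        have hy' : R ≤ ‖x - y‖ := by
          simpa [dist_eq_norm_sub'] using hy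
        have hpos : 0 < ‖x - y‖ := hR.trans_le hy'
        -- Once the power is written as an integral over radii t > |x - y|, exchanging the integrals
        -- leaves the ball B(x,t) as the domain of y.
        have h1 : ENNReal.ofReal (‖x - y‖ ^ (-γ)) =
            ENNReal.ofReal γ * ∫⁻ t in Ioi ‖x - y‖, ENNReal.ofReal (t ^ (-γ - 1)) := by
          rw [lintegral_Ioi_rpow_neg hγ hpos, ← ENNReal.ofReal_mul hγ.le]
          congr 1; field_simp
        rw [h1, mul_assoc, ← lintegral_mul_const _ (by fun_prop)]
        refine mul_le_mul_right ?_ _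
        rw [← lintegral_indicator measurableSet_Ioi, ← lintegral_indicator measurableSet_Ioi]
        refine lintegral_mono fun t => ?_
        by_cases ht : ‖x - y‖ < t
        · simp [indicator, hG, hS, ht, hy'.trans_lt ht]
        · simp [indicator, hG, hS, ht]
    _ = ENNReal.ofReal γ * ∫⁻ t in Ioi R, ∫⁻ y in (Metric.ball x R)ᶜ, G (y, t) := by
        rw [lintegral_const_mul _ (by exact hGm.lintegral_prod_right')]
        congr 1
        exact lintegral_lintegral_swap (f := fun y t => G (y, t)) hGm.aemeasurable
    _ ≤ _ := by
        gcongr with t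
        refine (setLIntegral_le_lintegral _ _).trans ?_
        rw [← lintegral_const_mul _ hH, ← lintegral_indicator Metric.isOpen_ball.measurableSet]
        refine lintegral_mono fun y => ?_
        by_cases ht : ‖x - y‖ < t
        · simp [indicator, hG, hS, ht, dist_eq_norm_sub']
        · simp [indicator, hG, hS, ht]

/-- The kernel away from the centre of the ball. -/
theorem roughKernel_sub_le {W : EuclideanSpace ℝ (Fin n) → ℝ≥0∞} {β R : ℝ} (hβ : 0 < β)
    (hR : 0 < R) {x₀ x y : EuclideanSpace ℝ (Fin n)} (hx : x ∈ Metric.ball x₀ R)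
    (hy : y ∈ (Metric.ball x₀ (2 * R))ᶜ) :
    roughKernel W β (x - y) ≤
      ENNReal.ofReal (2 ^ β) * (W (x - y) * ENNReal.ofReal (‖x₀ - y‖ ^ (-β))) := by
  have hy' : 2 * R ≤ ‖x₀ - y‖ := by simpa [dist_eq_norm_sub'] using hy
  have hx' : ‖x₀ - x‖ < R := by simpa [dist_eq_norm_sub'] using hx
  have h1 : ‖x₀ - y‖ ≤ ‖x₀ - x‖ + ‖x - y‖ := by
    simpa using norm_add_le (x₀ - x) (x - y)
  have h2 : ‖x₀ - y‖ / 2 ≤ ‖x - y‖ := by linarith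
  have h3 : 0 < ‖x₀ - y‖ := by linarith
  have h4 : ‖x - y‖ ^ (-β) ≤ 2 ^ β * ‖x₀ - y‖ ^ (-β) := by
    calc ‖x - y‖ ^ (-β) ≤ (‖x₀ - y‖ / 2) ^ (-β) :=
          Real.rpow_le_rpow_of_nonpos (by positivity) h2 (by linarith)
      _ = _ := by
          rw [Real.div_rpow h3.le zero_le_two, Real.rpow_neg zero_le_two, div_inv_eq_mul, mul_comm]
  rw [roughKernel, mul_left_comm, ← ENNReal.ofReal_mul (by positivity)]
  gcongr

/-- Centring the power at x₀ frees the radial weight from x; only the rough factor still depends on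
it. -/
theorem conv_indicator_compl_le {W F : EuclideanSpace ℝ (Fin n) → ℝ≥0∞} (hW : Measurable W)
    (hF : Measurable F) {β R : ℝ} (hβ : 0 < β)
    (hR : 0 < R) {x₀ x : EuclideanSpace ℝ (Fin n)} (hx : x ∈ Metric.ball x₀ R) :
    conv (roughKernel W β) ((Metric.ball x₀ (2 * R))ᶜ.indicator F) x ≤
      ENNReal.ofReal (2 ^ β) * ∫⁻ y in (Metric.ball x₀ (2 * R))ᶜ,
        ENNReal.ofReal (‖x₀ - y‖ ^ (-β)) * (W (x - y) * F y) := by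
  have hB : MeasurableSet (Metric.ball x₀ (2 * R))ᶜ := Metric.isOpen_ball.measurableSet.compl
  calc _ = ∫⁻ y in (Metric.ball x₀ (2 * R))ᶜ, roughKernel W β (x - y) * F y := by
        rw [conv, ← lintegral_indicator hB]
        refine lintegral_congr fun y => ?_
        simp only [indicator]
        split_ifs <;> simp
    _ ≤ ∫⁻ y in (Metric.ball x₀ (2 * R))ᶜ, ENNReal.ofReal (2 ^ β) *
        (ENNReal.ofReal (‖x₀ - y‖ ^ (-β)) * (W (x - y) * F y)) := by
        refine setLIntegral_mono' hB fun y hy => ?_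
        refine (mul_le_mul_left (roughKernel_sub_le hβ hR hx hy) _).trans_eq ?_
        ring
    _ = _ := lintegral_const_mul _ (by fun_prop)

/-- The contribution of the complement of `B(x₀, 2R)`, when `Ω` is integrable to the power `p'`. -/
theorem exists_ballNorm_far_le_of_conj [NeZero n] {W : EuclideanSpace ℝ (Fin n) → ℝ≥0∞}
    (hWm : Measurable W) (hW : HomogZero W) {p q u β : ℝ} (hu : u.HolderConjugate p) (hq : 0 < q)
    (hβ : 0 < β) (hβu : β - n / u = n / q)
    (hWu : ∫⁻ θ : Metric.sphere (0 : EuclideanSpace ℝ (Fin n)) 1, W θ ^ u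
      ∂(volume : Measure (EuclideanSpace ℝ (Fin n))).toSphere ≠ ∞) :
    ∃ C : ℝ≥0∞, C ≠ ∞ ∧ ∀ F : EuclideanSpace ℝ (Fin n) → ℝ≥0∞, Measurable F →
      ∀ x₀ R, 0 < R →
        ballNorm q (conv (roughKernel W β) ((Metric.ball x₀ (2 * R))ᶜ.indicator F)) x₀ R ≤
          C * ENNReal.ofReal (R ^ (n / q)) *
            ∫⁻ t in Ioi (2 * R), ENNReal.ofReal (t ^ (-(n / q) - 1)) * ballNorm p F x₀ t := by
  have hn : 0 < (n : ℝ) := Nat.cast_pos.2 (Nat.pos_of_ne_zero (NeZero.ne n))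
  have hu0 := hu.pos
  set D := ∫⁻ θ : Metric.sphere (0 : EuclideanSpace ℝ (Fin n)) 1, W θ ^ u
      ∂(volume : Measure (EuclideanSpace ℝ (Fin n))).toSphere with hD
  set V := volume (Metric.ball (0 : EuclideanSpace ℝ (Fin n)) 1) with hV
  -- For t > 2R, x - B(x₀,t) lies in B(0,2t), so c t^{n/u} bounds the L_u norm of W(x - ·) on
  -- B(x₀,t).
  set c : ℝ≥0∞ := (ENNReal.ofReal (2 ^ (n : ℝ) / n) * D) ^ (1 / u)
  refine ⟨V ^ (1 / q) * (ENNReal.ofReal (2 ^ β) * (ENNReal.ofReal β * c)), ?_, ?_⟩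
  · refine ENNReal.mul_ne_top (ENNReal.rpow_ne_top_of_nonneg (by positivity)
      measure_ball_lt_top.ne) (ENNReal.mul_ne_top ENNReal.ofReal_ne_top
      (ENNReal.mul_ne_top ENNReal.ofReal_ne_top (ENNReal.rpow_ne_top_of_nonneg (by positivity)
      (ENNReal.mul_ne_top ENNReal.ofReal_ne_top hWu))))
  intro F hF x₀ R hR
  have hmN : Measurable fun t : ℝ => ENNReal.ofReal (t ^ (-(n / q) - 1)) * ballNorm p F x₀ t :=
    Measurable.mul (by fun_prop) (ballNorm_mono hu.symm.pos F x₀).measurable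
  have key : ∀ x ∈ Metric.ball x₀ R,
      conv (roughKernel W β) ((Metric.ball x₀ (2 * R))ᶜ.indicator F) x ≤
      ENNReal.ofReal (2 ^ β) * (ENNReal.ofReal β * (c *
        ∫⁻ t in Ioi (2 * R), ENNReal.ofReal (t ^ (-(n / q) - 1)) * ballNorm p F x₀ t)) := by
    intro x hx
    refine (conv_indicator_compl_le hWm hF hβ hR hx).trans ?_
    refine mul_le_mul_right ((lintegral_compl_ball_le hβ (by positivity)
      (by fun_prop) x₀).trans ?_) _
    rw [← lintegral_const_mul _ hmN]
    refine mul_le_mul_right (setLIntegral_mono' measurableSet_Ioi fun t ht => ?_) _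
    have ht' : 2 * R < t := ht
    have ht0 : 0 < t := by linarith
    have hh := ENNReal.lintegral_mul_le_Lp_mul_Lq (volume.restrict (Metric.ball x₀ t)) hu
      (f := fun y => W (x - y)) (g := F) (by fun_prop) (by fun_prop)
    have hsub : ∫⁻ y in Metric.ball x₀ t, W (x - y) ^ u ≤
        ENNReal.ofReal ((2 * t) ^ (n : ℝ) / n) * D := by
      rw [hD, ← lintegral_ball_homog hWm hW u (by positivity : 0 < 2 * t),
        ← lintegral_indicator Metric.isOpen_ball.measurableSet,
        ← lintegral_indicator Metric.isOpen_ball.measurableSet,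
        ← lintegral_sub_left_eq_self ((Metric.ball 0 (2 * t)).indicator fun y => W y ^ u) x]
      refine lintegral_mono fun y => ?_
      by_cases hy : y ∈ Metric.ball x₀ t
      · have : x - y ∈ Metric.ball (0 : EuclideanSpace ℝ (Fin n)) (2 * t) := by
          rw [Metric.mem_ball, dist_zero_right, ← dist_eq_norm]
          calc dist x y ≤ dist x x₀ + dist y x₀ := dist_triangle_right x y x₀
            _ < R + t := add_lt_add hx hy
            _ < 2 * t := by linarith
        rw [indicator_of_mem hy, indicator_of_mem this]
      · rw [indicator_of_notMem hy]
        exact zero_le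
    have hc : (∫⁻ y in Metric.ball x₀ t, W (x - y) ^ u) ^ (1 / u) ≤
        c * ENNReal.ofReal (t ^ (n / u)) := by
      refine (ENNReal.rpow_le_rpow hsub (by positivity)).trans_eq ?_
      rw [Real.mul_rpow zero_le_two ht0.le, mul_div_right_comm,
        ENNReal.ofReal_mul (by positivity), mul_right_comm,
        ENNReal.mul_rpow_of_nonneg _ _ (by positivity),
        ENNReal.ofReal_rpow_of_pos (by positivity : 0 < t ^ (n : ℝ)), ← Real.rpow_mul ht0.le,
        mul_one_div]
    calc _ ≤ ENNReal.ofReal (t ^ (-β - 1)) *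
          ((c * ENNReal.ofReal (t ^ (n / u))) * ballNorm p F x₀ t) := by
          refine mul_le_mul_right (hh.trans ?_) _
          exact mul_le_mul_left hc _
      _ = c * ((ENNReal.ofReal (t ^ (-β - 1)) * ENNReal.ofReal (t ^ (n / u))) *
          ballNorm p F x₀ t) := by ring
      _ = _ := by
          rw [← ENNReal.ofReal_mul (by positivity), ← Real.rpow_add ht0,
            show -β - 1 + n / u = -(n / q) - 1 by linarith]
  -- The bound is uniform over the ball, so its L_q norm only adds the factor |B(x₀,R)|^{1/q}, which
  -- is the power R^{n/q}.
  refine (ballNorm_le_of_forall_le hq hR key).trans_eq ?_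
  ring

/-- The contribution of the complement of `B(x₀, 2R)`, by Minkowski's integral inequality. -/
theorem exists_ballNorm_far_le_of_lt [NeZero n] {W : EuclideanSpace ℝ (Fin n) → ℝ≥0∞}
    (hWm : Measurable W) {p q u β σ : ℝ} {D : ℝ≥0∞} (hD : D ≠ ∞)
    (hu : u.HolderConjugate p) (hq : 1 ≤ q) (hβ : 0 < β) (hβu : β - n / u = n / q)
    (hσq : 0 < n / q - n * σ)
    (hWD : ∀ x R ρ, 0 < R → 0 < ρ → Metric.ball x R ⊆ Metric.ball 0 ρ →
      ballNorm q W x R ≤ D * ENNReal.ofReal (R ^ (n / q - n * σ) * ρ ^ (n * σ))) :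
    ∃ C : ℝ≥0∞, C ≠ ∞ ∧ ∀ F : EuclideanSpace ℝ (Fin n) → ℝ≥0∞, Measurable F →
      ∀ x₀ R, 0 < R →
        ballNorm q (conv (roughKernel W β) ((Metric.ball x₀ (2 * R))ᶜ.indicator F)) x₀ R ≤
          C * ENNReal.ofReal (R ^ (n / q - n * σ)) *
            ∫⁻ t in Ioi (2 * R), ENNReal.ofReal (t ^ (-(n / q - n * σ) - 1)) *
              ballNorm p F x₀ t := by
  have hn : 0 < (n : ℝ) := Nat.cast_pos.2 (Nat.pos_of_ne_zero (NeZero.ne n))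
  have hu0 := hu.pos
  have hq0 : 0 < q := by linarith
  set V := volume (Metric.ball (0 : EuclideanSpace ℝ (Fin n)) 1) with hV
  have hnu : 0 < n / u := by positivity
  have hγ : 0 < β - n * σ := by linarith
  refine ⟨ENNReal.ofReal (2 ^ β) * (D * ENNReal.ofReal (2 ^ (n * σ))) *
    (ENNReal.ofReal (β - n * σ) * V ^ (1 / u)), ?_, ?_⟩
  · exact ENNReal.mul_ne_top (ENNReal.mul_ne_top ENNReal.ofReal_ne_top
      (ENNReal.mul_ne_top hD ENNReal.ofReal_ne_top)) (ENNReal.mul_ne_top ENNReal.ofReal_ne_top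
      (ENNReal.rpow_ne_top_of_nonneg (by positivity) measure_ball_lt_top.ne))
  intro F hF x₀ R hR
  have hB : MeasurableSet (Metric.ball x₀ (2 * R))ᶜ := Metric.isOpen_ball.measurableSet.compl
  have hmN : Measurable fun t : ℝ => ENNReal.ofReal (t ^ (-(n / q - n * σ) - 1)) *
      ballNorm p F x₀ t :=
    Measurable.mul (by fun_prop) (ballNorm_mono hu.symm.pos F x₀).measurable
  set ν := (volume : Measure (EuclideanSpace ℝ (Fin n))).restrict (Metric.ball x₀ (2 * R))ᶜ with hν
  -- The weight |x₀ - y|^{-β} is shared between k and w. The exponent -nσ of w is chosen to cancel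
  -- the growth ρ^{nσ} in `hWD` at ρ = 2|x₀ - y|; σ plays the role of 1/s.
  set k : EuclideanSpace ℝ (Fin n) → ℝ≥0∞ :=
    fun y => ENNReal.ofReal (‖x₀ - y‖ ^ (-(β - n * σ))) * F y with hk
  set w : EuclideanSpace ℝ (Fin n) → ℝ≥0∞ :=
    fun y => ENNReal.ofReal (‖x₀ - y‖ ^ (-(n * σ))) with hw
  have hkm : Measurable k := by fun_prop
  have hwm : Measurable w := by fun_prop
  set c : ℝ≥0∞ := D * ENNReal.ofReal (2 ^ (n * σ)) * ENNReal.ofReal (R ^ (n / q - n * σ)) with hc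
  -- Jensen with weight k, followed by Tonelli, serves as Minkowski's inequality: the factor (∫
  -- k)^{q-1} produced here combines with the last ∫ k into (∫ k)^q.
  have hpt : ∀ x ∈ Metric.ball x₀ R,
      conv (roughKernel W β) ((Metric.ball x₀ (2 * R))ᶜ.indicator F) x ^ q ≤
      ENNReal.ofReal (2 ^ β) ^ q * ((∫⁻ y, k y ∂ν) ^ (q - 1) *
        ∫⁻ y, k y * (W (x - y) * w y) ^ q ∂ν) := by
    intro x hx
    have h1 : ∫⁻ y, ENNReal.ofReal (‖x₀ - y‖ ^ (-β)) * (W (x - y) * F y) ∂ν =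
        ∫⁻ y, k y * (W (x - y) * w y) ∂ν := by
      refine setLIntegral_congr_fun hB fun y hy => ?_
      have hρ : 0 < ‖x₀ - y‖ := by
        have : 2 * R ≤ ‖x₀ - y‖ := by simpa [dist_eq_norm_sub'] using hy
        linarith
      have h2 : ENNReal.ofReal (‖x₀ - y‖ ^ (-β)) = ENNReal.ofReal (‖x₀ - y‖ ^ (-(β - n * σ))) *
          ENNReal.ofReal (‖x₀ - y‖ ^ (-(n * σ))) := by
        rw [← ENNReal.ofReal_mul (by positivity), ← Real.rpow_add hρ]
        congr 2; ring
      simp only [hk, hw, h2]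
      ring
    refine (ENNReal.rpow_le_rpow (conv_indicator_compl_le hWm hF hβ hR hx) hq0.le).trans ?_
    rw [ENNReal.mul_rpow_of_nonneg _ _ hq0.le, h1]
    exact mul_le_mul_right (rpow_lintegral_mul_le (by fun_prop) (by fun_prop) hq) _
  -- After translation by y the ball B(x₀ - y, R) lies in B(0, 2|x₀ - y|), and the resulting bound c
  -- no longer depends on y.
  have hinner : ∀ y ∈ (Metric.ball x₀ (2 * R))ᶜ,
      ∫⁻ x in Metric.ball x₀ R, k y * (W (x - y) * w y) ^ q ≤ k y * c ^ q := by
    intro y hy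
    have hρ2 : 2 * R ≤ ‖x₀ - y‖ := by simpa [dist_eq_norm_sub'] using hy
    have hρ : 0 < ‖x₀ - y‖ := by linarith
    rw [lintegral_const_mul _ (by fun_prop)]
    refine mul_le_mul_right ?_ _
    simp only [ENNReal.mul_rpow_of_nonneg _ _ hq0.le]
    rw [lintegral_mul_const _ (by fun_prop)]
    have hshift : ∫⁻ x in Metric.ball x₀ R, W (x - y) ^ q = ballNorm q W (x₀ - y) R ^ q := by
      rw [ballNorm, ← ENNReal.rpow_mul, show 1 / q * q = 1 by field_simp, ENNReal.rpow_one,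
        ← lintegral_indicator Metric.isOpen_ball.measurableSet,
        ← lintegral_indicator Metric.isOpen_ball.measurableSet,
        ← lintegral_sub_right_eq_self ((Metric.ball (x₀ - y) R).indicator fun z => W z ^ q) y]
      refine lintegral_congr fun x => ?_
      simp [indicator, dist_eq_norm]
    have hsub : Metric.ball (x₀ - y) R ⊆ Metric.ball 0 (2 * ‖x₀ - y‖) := by
      refine Metric.ball_subset_ball' ?_
      rw [dist_zero_right]; linarith
    rw [hshift, ← ENNReal.mul_rpow_of_nonneg _ _ hq0.le]
    refine ENNReal.rpow_le_rpow ?_ hq0.le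
    calc _ ≤ D * ENNReal.ofReal (R ^ (n / q - n * σ) * (2 * ‖x₀ - y‖) ^ (n * σ)) * w y := by
          gcongr
          exact hWD _ _ _ hR (by positivity) hsub
      _ = c := by
          rw [hc, hw, mul_assoc, mul_assoc, ← ENNReal.ofReal_mul (by positivity),
            ← ENNReal.ofReal_mul (by positivity), Real.mul_rpow zero_le_two hρ.le,
            Real.rpow_neg hρ.le]
          congr 2
          have : ‖x₀ - y‖ ^ (n * σ) ≠ 0 := (Real.rpow_pos_of_pos hρ _).ne'
          field_simp
  -- Layers of radius t, then Hölder for F alone on each ball; n/u is absorbed through β - n/u =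
  -- n/q.
  have hk_int : ∫⁻ y, k y ∂ν ≤ ENNReal.ofReal (β - n * σ) * V ^ (1 / u) *
      ∫⁻ t in Ioi (2 * R), ENNReal.ofReal (t ^ (-(n / q - n * σ) - 1)) * ballNorm p F x₀ t := by
    refine (lintegral_compl_ball_le hγ (by positivity) hF x₀).trans ?_
    rw [mul_assoc, ← lintegral_const_mul _ hmN]
    refine mul_le_mul_right (setLIntegral_mono' measurableSet_Ioi fun t ht => ?_) _
    have ht' : 2 * R < t := ht
    have ht0 : 0 < t := by linarith
    calc _ ≤ ENNReal.ofReal (t ^ (-(β - n * σ) - 1)) *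
          (V ^ (1 / u) * ENNReal.ofReal (t ^ (n / u)) * ballNorm p F x₀ t) :=
          mul_le_mul_right (setLIntegral_ball_le hu hF x₀ ht0) _
      _ = V ^ (1 / u) * ((ENNReal.ofReal (t ^ (-(β - n * σ) - 1)) * ENNReal.ofReal (t ^ (n / u))) *
          ballNorm p F x₀ t) := by ring
      _ = _ := by
          rw [← ENNReal.ofReal_mul (by positivity), ← Real.rpow_add ht0,
            show -(β - n * σ) - 1 + n / u = -(n / q - n * σ) - 1 by linarith]
  have hmain : ballNorm q (conv (roughKernel W β) ((Metric.ball x₀ (2 * R))ᶜ.indicator F)) x₀ R ≤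
      ENNReal.ofReal (2 ^ β) * c * ∫⁻ y, k y ∂ν := by
    set A := ENNReal.ofReal (2 ^ β)
    set k₀ := ∫⁻ y, k y ∂ν with hk₀
    have hm2 : Measurable fun z : EuclideanSpace ℝ (Fin n) × EuclideanSpace ℝ (Fin n) =>
        k z.2 * (W (z.1 - z.2) * w z.2) ^ q := by fun_prop
    have : ∫⁻ x in Metric.ball x₀ R,
        conv (roughKernel W β) ((Metric.ball x₀ (2 * R))ᶜ.indicator F) x ^ q ≤
        (A * c * k₀) ^ q := by
      calc _ ≤ ∫⁻ x in Metric.ball x₀ R, A ^ q * (k₀ ^ (q - 1) *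
            ∫⁻ y, k y * (W (x - y) * w y) ^ q ∂ν) :=
            setLIntegral_mono' Metric.isOpen_ball.measurableSet hpt
        _ = A ^ q * (k₀ ^ (q - 1) * ∫⁻ x in Metric.ball x₀ R,
            (∫⁻ y, k y * (W (x - y) * w y) ^ q ∂ν)) := by
            rw [lintegral_const_mul _ (hm2.lintegral_prod_right'.const_mul _),
              lintegral_const_mul _ hm2.lintegral_prod_right']
        _ = A ^ q * (k₀ ^ (q - 1) * ∫⁻ y, (∫⁻ x in Metric.ball x₀ R,
            k y * (W (x - y) * w y) ^ q) ∂ν) := by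
            congr 2
            exact lintegral_lintegral_swap (f := fun x y => k y * (W (x - y) * w y) ^ q)
              hm2.aemeasurable
        _ ≤ A ^ q * (k₀ ^ (q - 1) * ∫⁻ y, k y * c ^ q ∂ν) := by
            gcongr A ^ q * (k₀ ^ (q - 1) * ?_)
            exact setLIntegral_mono' hB hinner
        _ = _ := by
            rw [lintegral_mul_const _ hkm, ← hk₀, ENNReal.mul_rpow_of_nonneg (A * c) k₀ hq0.le,
              ENNReal.mul_rpow_of_nonneg A c hq0.le]
            have : k₀ ^ q = k₀ ^ (q - 1) * k₀ := by
              nth_rw 3 [← ENNReal.rpow_one k₀]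
              rw [← ENNReal.rpow_add_of_nonneg _ _ (by linarith) zero_le_one]
              congr 1; ring
            rw [this]; ring
    refine (ENNReal.rpow_le_rpow this (by positivity)).trans_eq ?_
    rw [← ENNReal.rpow_mul, show q * (1 / q) = 1 by field_simp, ENNReal.rpow_one]
  calc _ ≤ _ := hmain
    _ ≤ ENNReal.ofReal (2 ^ β) * c * (ENNReal.ofReal (β - n * σ) * V ^ (1 / u) *
      ∫⁻ t in Ioi (2 * R), ENNReal.ofReal (t ^ (-(n / q - n * σ) - 1)) * ballNorm p F x₀ t) :=
        mul_le_mul_right hk_int _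
    _ = _ := by rw [hc]; ring

end

/-! ### Size of Ω on balls, and the local estimate from near and far parts -/

section

variable {n : ℕ}

theorem lintegral_rpow_ne_top_of_memLp {X : Type*} [MeasurableSpace X] {μ : Measure X}
    [IsFiniteMeasure μ] {f : X → ℝ≥0∞} {s : ℝ≥0∞} (hf : MemLp f s μ) {u : ℝ} (hu : 0 < u)
    (hus : ENNReal.ofReal u ≤ s) : ∫⁻ x, f x ^ u ∂μ ≠ ∞ := by
  have h := (hf.mono_exponent hus).2
  rw [eLpNorm_lt_top_iff_lintegral_rpow_enorm_lt_top (by simpa using hu) ENNReal.ofReal_ne_top,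
    ENNReal.toReal_ofReal hu.le] at h
  simpa using h.ne

/-- The `L_s` norm of a homogeneous function on centred balls. -/
theorem exists_eLpNorm_ball_le [NeZero n] {W : EuclideanSpace ℝ (Fin n) → ℝ≥0∞}
    (hWm : Measurable W) (hW : HomogZero W) {s : ℝ≥0∞} (hs : 1 < s)
    (hWs : MemLp (fun θ : Metric.sphere (0 : EuclideanSpace ℝ (Fin n)) 1 => W θ) s
      (volume : Measure (EuclideanSpace ℝ (Fin n))).toSphere) :
    ∃ D : ℝ≥0∞, D ≠ ∞ ∧ ∀ ρ : ℝ, 0 < ρ →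
      eLpNorm W s (volume.restrict (Metric.ball 0 ρ)) ≤
        D * ENNReal.ofReal (ρ ^ (n * (s⁻¹).toReal)) := by
  have hn : 0 < (n : ℝ) := Nat.cast_pos.2 (Nat.pos_of_ne_zero (NeZero.ne n))
  rcases eq_or_ne s ∞ with rfl | hst
  · set M := eLpNorm (fun θ : Metric.sphere (0 : EuclideanSpace ℝ (Fin n)) 1 => W θ) ∞
      (volume : Measure (EuclideanSpace ℝ (Fin n))).toSphere with hM
    refine ⟨M, hWs.2.ne, fun ρ hρ => ?_⟩
    rw [eLpNorm_exponent_top]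
    simp only [ENNReal.inv_top, ENNReal.toReal_zero, mul_zero, Real.rpow_zero, ENNReal.ofReal_one,
      mul_one]
    refine eLpNormEssSup_le_of_ae_enorm_bound (ae_restrict_of_ae ?_)
    -- Away from the origin the exceptional set is a cone by homogeneity. Almost no direction
    -- belongs to it, so polar coordinates give it measure zero.
    have hset : MeasurableSet {x | M < W x} := measurableSet_lt measurable_const hWm
    rw [ae_iff]
    simp only [enorm_eq_self, not_le]
    rw [← lintegral_indicator_one hset, lintegral_polar _ (measurable_one.indicator hset)]
    rw [lintegral_eq_zero_iff' ?_]
    · have hae : ∀ᵐ θ : Metric.sphere (0 : EuclideanSpace ℝ (Fin n)) 1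
          ∂(volume : Measure (EuclideanSpace ℝ (Fin n))).toSphere, W θ ≤ M := by
        simpa [hM, eLpNorm_exponent_top] using
          ae_le_eLpNormEssSup (f := fun θ : Metric.sphere (0 : EuclideanSpace ℝ (Fin n)) 1 => W θ)
      filter_upwards [hae] with θ hθ
      simp only [Pi.zero_apply]
      rw [← lintegral_zero (μ := volume.restrict (Ioi (0 : ℝ)))]
      refine setLIntegral_congr_fun measurableSet_Ioi fun t ht => ?_
      simp [indicator, hW.smul_sphere ht, not_lt.2 hθ]
    · refine Measurable.aemeasurable ?_
      have : Measurable fun z : Metric.sphere (0 : EuclideanSpace ℝ (Fin n)) 1 × ℝ =>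
          ENNReal.ofReal (z.2 ^ ((n : ℝ) - 1)) *
            ({x | M < W x}.indicator 1 (z.2 • (z.1 : EuclideanSpace ℝ (Fin n))) : ℝ≥0∞) :=
        Measurable.mul (by fun_prop) ((measurable_one.indicator hset).comp (by fun_prop))
      exact this.lintegral_prod_right'
  · have hs0 : s ≠ 0 := (zero_lt_one.trans hs).ne'
    have hs0' : 0 < s.toReal := ENNReal.toReal_pos hs0 hst
    set I := ∫⁻ θ : Metric.sphere (0 : EuclideanSpace ℝ (Fin n)) 1, W θ ^ s.toReal
      ∂(volume : Measure (EuclideanSpace ℝ (Fin n))).toSphere with hI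
    have hIt : I ≠ ∞ := lintegral_rpow_ne_top_of_memLp hWs hs0'
      (by rw [ENNReal.ofReal_toReal hst])
    refine ⟨(ENNReal.ofReal (1 / n) * I) ^ (1 / s.toReal), ENNReal.rpow_ne_top_of_nonneg
      (by positivity) (ENNReal.mul_ne_top ENNReal.ofReal_ne_top hIt), fun ρ hρ => ?_⟩
    rw [eLpNorm_eq_lintegral_rpow_enorm_toReal hs0 hst]
    simp only [enorm_eq_self]
    rw [lintegral_ball_homog hWm hW _ hρ, div_eq_mul_one_div, ENNReal.ofReal_mul (by positivity),
      mul_assoc, mul_comm, ENNReal.mul_rpow_of_nonneg _ _ (by positivity),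
      ENNReal.ofReal_rpow_of_pos (by positivity), ← Real.rpow_mul hρ.le, ENNReal.toReal_inv]
    simp only [one_div]
    exact le_rfl

/-- Hölder from L_s down to L_q on the small ball gains R^{n/q-n/s}, while the L_s norm is only
controlled on the large centred ball, where it grows like ρ^{n/s}. -/
theorem exists_ballNorm_homog_le [NeZero n] {W : EuclideanSpace ℝ (Fin n) → ℝ≥0∞}
    (hWm : Measurable W) (hW : HomogZero W) {s : ℝ≥0∞} (hs : 1 < s)
    (hWs : MemLp (fun θ : Metric.sphere (0 : EuclideanSpace ℝ (Fin n)) 1 => W θ) s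
      (volume : Measure (EuclideanSpace ℝ (Fin n))).toSphere) {q : ℝ} (hq : 0 < q)
    (hqs : ENNReal.ofReal q ≤ s) :
    ∃ D : ℝ≥0∞, D ≠ ∞ ∧ ∀ x R ρ, 0 < R → 0 < ρ → Metric.ball x R ⊆ Metric.ball 0 ρ →
      ballNorm q W x R ≤ D * ENNReal.ofReal (R ^ (n / q - n * (s⁻¹).toReal) *
        ρ ^ (n * (s⁻¹).toReal)) := by
  obtain ⟨D, hD, h⟩ := exists_eLpNorm_ball_le hWm hW hs hWs
  have hq0 : ENNReal.ofReal q ≠ 0 := by simpa using hq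
  have he : 0 ≤ 1 / q - (s⁻¹).toReal := by
    have := ENNReal.toReal_mono (by simpa using hq) (ENNReal.inv_le_inv.2 hqs)
    rw [ENNReal.toReal_inv (ENNReal.ofReal q), ENNReal.toReal_ofReal hq.le] at this
    rw [one_div]; linarith
  set V := volume (Metric.ball (0 : EuclideanSpace ℝ (Fin n)) 1) with hV
  refine ⟨D * V ^ (1 / q - (s⁻¹).toReal), ENNReal.mul_ne_top hD
    (ENNReal.rpow_ne_top_of_nonneg he measure_ball_lt_top.ne), fun x R ρ hR hρ hsub => ?_⟩
  have h1 : ballNorm q W x R = eLpNorm W (ENNReal.ofReal q)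
      (volume.restrict (Metric.ball x R)) := by
    rw [eLpNorm_eq_lintegral_rpow_enorm_toReal hq0 ENNReal.ofReal_ne_top,
      ENNReal.toReal_ofReal hq.le]
    rfl
  rw [h1]
  calc _ ≤ eLpNorm W s (volume.restrict (Metric.ball x R)) *
        (volume.restrict (Metric.ball x R)) univ ^ (1 / (ENNReal.ofReal q).toReal - 1 / s.toReal) :=
        eLpNorm_le_eLpNorm_mul_rpow_measure_univ hqs hWm.aestronglyMeasurable
    _ ≤ (D * ENNReal.ofReal (ρ ^ (n * (s⁻¹).toReal))) *
        (ENNReal.ofReal (R ^ (n : ℝ)) * V) ^ (1 / q - (s⁻¹).toReal) := by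
        rw [Measure.restrict_apply_univ, volume_ball_eq x hR, ENNReal.toReal_ofReal hq.le,
          one_div s.toReal, ← ENNReal.toReal_inv]
        refine mul_le_mul_left ?_ _
        exact (eLpNorm_mono_measure _ (Measure.restrict_mono_set _ hsub)).trans (h ρ hρ)
    _ = _ := by
        rw [ENNReal.mul_rpow_of_nonneg _ _ he, ENNReal.ofReal_rpow_of_pos (by positivity),
          ← Real.rpow_mul hR.le, ENNReal.ofReal_mul (by positivity),
          show n * (1 / q - (s⁻¹).toReal) = n / q - n * (s⁻¹).toReal by ring]
        ring

/-- The local estimate: a global `L_p`-`L_q` bound controls the part of the function near the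
ball, and a tail bound controls the rest. -/
theorem exists_ballNorm_conv_le {K : EuclideanSpace ℝ (Fin n) → ℝ≥0∞} (hK : Measurable K)
    {p q κ : ℝ} (hp : 0 < p) (hq : 1 ≤ q) (hκ : 0 < κ)
    (hglob : ∃ C : ℝ≥0, ∀ F : EuclideanSpace ℝ (Fin n) → ℝ≥0∞, Measurable F →
      (∫⁻ x, conv K F x ^ q) ^ (1 / q) ≤ C * (∫⁻ x, F x ^ p) ^ (1 / p))
    (hfar : ∃ C : ℝ≥0∞, C ≠ ∞ ∧ ∀ F : EuclideanSpace ℝ (Fin n) → ℝ≥0∞, Measurable F →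
      ∀ x₀ R, 0 < R →
        ballNorm q (conv K ((Metric.ball x₀ (2 * R))ᶜ.indicator F)) x₀ R ≤
          C * ENNReal.ofReal (R ^ κ) *
            ∫⁻ t in Ioi (2 * R), ENNReal.ofReal (t ^ (-κ - 1)) * ballNorm p F x₀ t) :
    ∃ C : ℝ≥0, ∀ F : EuclideanSpace ℝ (Fin n) → ℝ≥0∞, Measurable F → ∀ x₀ R, 0 < R →
      ballNorm q (conv K F) x₀ R ≤ C * ENNReal.ofReal (R ^ κ) *
        ∫⁻ t in Ioi R, ENNReal.ofReal (t ^ (-κ - 1)) * ballNorm p F x₀ t := by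
  obtain ⟨C₁, h₁⟩ := hglob
  obtain ⟨C₂, hC₂, h₂⟩ := hfar
  have hq0 : 0 < q := by linarith
  refine ⟨(C₁ * ENNReal.ofReal (κ * 2 ^ κ) + C₂).toNNReal, fun F hF x₀ R hR => ?_⟩
  rw [ENNReal.coe_toNNReal (ENNReal.add_ne_top.2
    ⟨ENNReal.mul_ne_top ENNReal.coe_ne_top ENNReal.ofReal_ne_top, hC₂⟩)]
  have hB : MeasurableSet (Metric.ball x₀ (2 * R)) := Metric.isOpen_ball.measurableSet
  set J := ∫⁻ t in Ioi (2 * R), ENNReal.ofReal (t ^ (-κ - 1)) * ballNorm p F x₀ t with hJ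
  have hJle : J ≤ ∫⁻ t in Ioi R, ENNReal.ofReal (t ^ (-κ - 1)) * ballNorm p F x₀ t :=
    lintegral_mono_set (Ioi_subset_Ioi (by linarith))
  set F₁ := (Metric.ball x₀ (2 * R)).indicator F
  set F₂ := (Metric.ball x₀ (2 * R))ᶜ.indicator F
  have hF₁ : Measurable F₁ := hF.indicator hB
  have hF₂ : Measurable F₂ := hF.indicator hB.compl
  have hsplit : conv K F = fun x => conv K F₁ x + conv K F₂ x := by
    ext x
    rw [← conv_add_right hK hF₁]
    congr 1
    exact (indicator_self_add_compl _ F).symm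
  have hnear : ballNorm q (conv K F₁) x₀ R ≤
      C₁ * ENNReal.ofReal (κ * 2 ^ κ) * ENNReal.ofReal (R ^ κ) * J := by
    have e : ∫⁻ x, F₁ x ^ p = ∫⁻ x in Metric.ball x₀ (2 * R), F x ^ p := by
      rw [← lintegral_indicator hB]
      refine lintegral_congr fun x => ?_
      simp only [F₁, indicator]
      split_ifs <;> simp [hp]
    calc ballNorm q (conv K F₁) x₀ R ≤ (∫⁻ x, conv K F₁ x ^ q) ^ (1 / q) :=
          ENNReal.rpow_le_rpow (setLIntegral_le_lintegral _ _) (by positivity)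
      _ ≤ C₁ * ballNorm p F x₀ (2 * R) := by
          refine (h₁ F₁ hF₁).trans_eq ?_
          rw [e]; rfl
      _ ≤ C₁ * (ENNReal.ofReal (κ * 2 ^ κ) * ENNReal.ofReal (R ^ κ) * J) := by
          gcongr
          -- The norm over B(x₀,t) increases with t, so its value at 2R can be pulled out of the
          -- tail integral; κ 2^κ R^κ is the inverse of the remaining factor.
          have h3 : ENNReal.ofReal ((2 * R) ^ (-κ) / κ) * ballNorm p F x₀ (2 * R) ≤ J := by
            rw [← lintegral_Ioi_rpow_neg hκ (by positivity : 0 < 2 * R),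
              ← lintegral_mul_const _ (by fun_prop)]
            refine setLIntegral_mono' measurableSet_Ioi fun t ht => ?_
            exact mul_le_mul_right (ballNorm_mono hp F x₀ (le_of_lt ht)) _
          refine le_trans ?_ (mul_le_mul_right h3 _)
          rw [← mul_assoc, ← ENNReal.ofReal_mul (by positivity), ← ENNReal.ofReal_mul (by positivity)]
          have : κ * 2 ^ κ * R ^ κ * ((2 * R) ^ (-κ) / κ) = 1 := by
            rw [Real.rpow_neg (by positivity), Real.mul_rpow zero_le_two hR.le]
            have h4 : (2 : ℝ) ^ κ ≠ 0 := by positivity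
            have h5 : R ^ κ ≠ 0 := by positivity
            field_simp
          rw [this]; simp
      _ = _ := by ring
  calc ballNorm q (conv K F) x₀ R ≤ ballNorm q (conv K F₁) x₀ R + ballNorm q (conv K F₂) x₀ R := by
        rw [hsplit]
        exact ballNorm_add_le hq (measurable_conv hK hF₁) (measurable_conv hK hF₂) _ _
    _ ≤ C₁ * ENNReal.ofReal (κ * 2 ^ κ) * ENNReal.ofReal (R ^ κ) * J +
        C₂ * ENNReal.ofReal (R ^ κ) * J := add_le_add hnear (h₂ F hF x₀ R hR)
    _ = (C₁ * ENNReal.ofReal (κ * 2 ^ κ) + C₂) * ENNReal.ofReal (R ^ κ) * J := by ring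
    _ ≤ _ := by gcongr

end

/-! ### Exponent arithmetic and the local estimate in both cases -/

section

variable {n : ℕ}

/-- Conjugation reverses order: s' ≤ p amounts to p' ≤ s. -/
theorem ofReal_le_of_conjExponent_le {s : ℝ≥0∞} (hs : 1 < s) {p u : ℝ} (hu : u.HolderConjugate p)
    (h : ENNReal.conjExponent s ≤ ENNReal.ofReal p) : ENNReal.ofReal u ≤ s := by
  rcases eq_or_ne s ∞ with rfl | hst
  · exact le_top
  lift s to ℝ≥0 using hst
  have hs' : 1 < s := by exact_mod_cast hs
  rw [← ENNReal.coe_conjExponent hs', ← ENNReal.ofReal_coe_nnreal,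
    ENNReal.ofReal_le_ofReal_iff hu.symm.nonneg] at h
  rw [← ENNReal.ofReal_coe_nnreal]
  refine ENNReal.ofReal_le_ofReal ?_
  have hc : (s : ℝ).HolderConjugate (s.conjExponent : ℝ) := by
    exact_mod_cast NNReal.HolderConjugate.conjExponent hs'
  have h1 := hc.inv_add_inv_eq_one
  have h2 := hu.inv_add_inv_eq_one
  have h3 : p⁻¹ ≤ (s.conjExponent : ℝ)⁻¹ := inv_anti₀ hc.symm.pos h
  have h4 : (s : ℝ)⁻¹ ≤ u⁻¹ := by linarith
  exact (inv_le_inv₀ hc.pos hu.pos).1 h4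

/-- The global `L_p`-`L_q` bound for the rough fractional integral. -/
theorem exists_lintegral_conv_roughKernel_le [NeZero n] {W : EuclideanSpace ℝ (Fin n) → ℝ≥0∞}
    (hWm : Measurable W) (hW : HomogZero W) {α p q : ℝ} (hα : 0 < α) (hαn : α < n) (hp : 1 < p)
    (hpα : α / n < 1 / p) (hq : 1 / q = 1 / p - α / n)
    (hWr : ∫⁻ θ : Metric.sphere (0 : EuclideanSpace ℝ (Fin n)) 1, W θ ^ ((n : ℝ) / (n - α))
      ∂(volume : Measure (EuclideanSpace ℝ (Fin n))).toSphere ≠ ∞) :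
    ∃ C : ℝ≥0, ∀ F : EuclideanSpace ℝ (Fin n) → ℝ≥0∞, Measurable F →
      (∫⁻ x, conv (roughKernel W (n - α)) F x ^ q) ^ (1 / q) ≤
        C * (∫⁻ x, F x ^ p) ^ (1 / p) := by
  have hn : 0 < (n : ℝ) := hα.trans hαn
  have hnα : 0 < (n : ℝ) - α := by linarith
  set r : ℝ := n / (n - α) with hr
  have hr1 : 1 < r := by rw [hr, one_lt_div hnα]; linarith
  have hnr : (n : ℝ) - α = n / r := by rw [hr]; field_simp
  have hrinv : 1 / r = 1 - α / n := by rw [hr]; field_simp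
  have hq0 : 0 < q := by
    have : 0 < 1 / q := by linarith
    exact one_div_pos.1 this
  have hu : (Real.conjExponent p).HolderConjugate p := (Real.HolderConjugate.conjExponent hp).symm
  -- 1/r = 1 - α/n exceeds 1 - 1/p because α/n < 1/p; the L_{p'} bound for the low part of the
  -- kernel needs this strict gap.
  have hru : r < Real.conjExponent p := by
    have h2 := hu.inv_add_inv_eq_one
    simp only [← one_div] at h2
    refine (one_div_lt_one_div hu.pos (by linarith)).1 ?_
    linarith
  rw [hnr]
  exact exists_lintegral_conv_rpow_le (measurable_roughKernel hWm _) hp (by linarith) hq0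
    (by linarith) hu (ENNReal.mul_ne_top ENNReal.ofReal_ne_top hWr)
    (ENNReal.mul_ne_top ENNReal.ofReal_ne_top hWr)
    (fun τ hτ => (lintegral_roughKernel_gt hWm hW hr1 hτ).le)
    (fun τ hτ => lintegral_roughKernel_le hWm hW hr1 hru hτ)

theorem tail_exponent_pos {s : ℝ≥0∞} {q N : ℝ} (hN : 0 < N) (hq : 0 < q)
    (h : ENNReal.ofReal q < s) : 0 < N / q - N * (s⁻¹).toReal := by
  have h1 : (s⁻¹).toReal < 1 / q := by
    have h2 := (ENNReal.toReal_lt_toReal (by simpa using (zero_le.trans_lt h).ne')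
      (by simpa using hq)).2 (ENNReal.inv_lt_inv.2 h)
    rwa [ENNReal.toReal_inv (ENNReal.ofReal q), ENNReal.toReal_ofReal hq.le, ← one_div q] at h2
  rw [show N / q - N * (s⁻¹).toReal = N * (1 / q - (s⁻¹).toReal) by ring]
  exact mul_pos hN (by linarith)

/-- The local estimate for the rough fractional integral, in both ranges of exponents. -/
theorem exists_ballNorm_roughKernel_le {W : EuclideanSpace ℝ (Fin n) → ℝ≥0∞}
    (hWm : Measurable W) (hW : HomogZero W) {s : ℝ≥0∞} (hs : 1 < s)
    (hWs : MemLp (fun θ : Metric.sphere (0 : EuclideanSpace ℝ (Fin n)) 1 => W θ) s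
      (volume : Measure (EuclideanSpace ℝ (Fin n))).toSphere)
    {α p q κ : ℝ} (hα : 0 < α) (hαn : α < n) (hp : 1 < p)
    (hpα : p < n / α) (hq : 1 / q = 1 / p - α / n)
    (hcase : (ENNReal.conjExponent s ≤ ENNReal.ofReal p ∧ κ = n / q) ∨
      (ENNReal.ofReal q < s ∧ κ = n / q - n * (s⁻¹).toReal)) :
    0 < q ∧ 0 < κ ∧
    ∃ C : ℝ≥0, ∀ F : EuclideanSpace ℝ (Fin n) → ℝ≥0∞, Measurable F → ∀ x₀ R, 0 < R →
      ballNorm q (conv (roughKernel W (n - α)) F) x₀ R ≤ C * ENNReal.ofReal (R ^ κ) *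
        ∫⁻ t in Ioi R, ENNReal.ofReal (t ^ (-κ - 1)) * ballNorm p F x₀ t := by
  have hn : 0 < (n : ℝ) := hα.trans hαn
  have : NeZero n := ⟨by rintro rfl; simp at hn⟩
  have hp0 : 0 < p := by linarith
  have hnα : 0 < (n : ℝ) - α := by linarith
  have hpα' : α / n < 1 / p := by
    rw [lt_div_iff₀ hα] at hpα
    rw [div_lt_div_iff₀ hn hp0]
    linarith
  have hqinv : 0 < 1 / q := by linarith
  have hq0 : 0 < q := one_div_pos.1 hqinv
  have hpq : 1 / q < 1 := by
    have h1 : 1 / p < 1 := by rw [div_lt_one hp0]; exact hp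
    have h2 : 0 < α / n := by positivity
    linarith
  have hq1 : 1 ≤ q := by
    rw [div_lt_one hq0] at hpq; exact hpq.le
  have hu : (Real.conjExponent p).HolderConjugate p := (Real.HolderConjugate.conjExponent hp).symm
  set u := Real.conjExponent p
  have huinv := hu.inv_add_inv_eq_one
  simp only [← one_div] at huinv
  have hr : 0 < (n : ℝ) / (n - α) := by positivity
  have hrinv : 1 / ((n : ℝ) / (n - α)) = 1 - α / n := by field_simp
  have hβ : (n : ℝ) - α - n / u = n / q := by
    have h1 : (n : ℝ) / u = n * (1 - 1 / p) := by
      rw [show 1 - 1 / p = 1 / u by linarith]; ring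
    have h2 : (n : ℝ) / q = n * (1 / q) := by ring
    have h3 : (n : ℝ) * (α / n) = α := by field_simp
    rw [h1, h2, hq, mul_sub, mul_sub, h3]
    ring
  -- With r = n/(n-α): r < p' ≤ s in the first case, and r < q < s in the second because 1/q = 1/p -
  -- α/n < 1 - α/n = 1/r.
  have hrs : ENNReal.ofReal ((n : ℝ) / (n - α)) ≤ s := by
    rcases hcase with h | h
    · refine (ENNReal.ofReal_le_ofReal ?_).trans (ofReal_le_of_conjExponent_le hs hu h.1)
      refine ((one_div_lt_one_div hu.pos hr).1 ?_).le
      linarith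
    · refine (ENNReal.ofReal_le_ofReal ?_).trans h.1.le
      refine ((one_div_lt_one_div hq0 hr).1 ?_).le
      have h1 : 1 / p < 1 := by rw [div_lt_one hp0]; exact hp
      linarith
  have hglob := exists_lintegral_conv_roughKernel_le hWm hW hα hαn hp hpα' hq
    (lintegral_rpow_ne_top_of_memLp hWs hr hrs)
  have hKm := measurable_roughKernel hWm (n - α)
  rcases hcase with ⟨h, rfl⟩ | ⟨h, rfl⟩
  · have hκ : 0 < n / q := by positivity
    refine ⟨hq0, hκ, exists_ballNorm_conv_le hKm hp0 hq1 hκ hglob ?_⟩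
    exact exists_ballNorm_far_le_of_conj hWm hW hu hq0 hnα hβ
      (lintegral_rpow_ne_top_of_memLp hWs hu.pos (ofReal_le_of_conjExponent_le hs hu h))
  · have hκ := tail_exponent_pos hn hq0 h
    refine ⟨hq0, hκ, exists_ballNorm_conv_le hKm hp0 hq1 hκ hglob ?_⟩
    obtain ⟨D, hD, hWD⟩ := exists_ballNorm_homog_le hWm hW hs hWs hq0 h.le
    exact exists_ballNorm_far_le_of_lt hWm hD hu hq1 hnα hβ hκ hWD

/-- `r^κ / φ(x, r) → 0` as `r → 0`, uniformly in `x`, when `φ` is bounded below. -/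
theorem BoundedBelow.tendsto {φ : EuclideanSpace ℝ (Fin n) → ℝ → ℝ} (h : BoundedBelow φ) {κ : ℝ}
    (hκ : 0 < κ) :
    Tendsto (fun t : ℝ => ⨆ x : EuclideanSpace ℝ (Fin n), ENNReal.ofReal (t ^ κ / φ x t))
      (𝓝[>] 0) (𝓝 0) := by
  obtain ⟨c, hc, hφ⟩ := h
  have h1 : Tendsto (fun t : ℝ => ENNReal.ofReal (t ^ κ / c)) (𝓝[>] 0) (𝓝 0) := by
    have h2 : Tendsto (fun t : ℝ => t ^ κ / c) (𝓝[>] 0) (𝓝 0) := by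
      have h3 : ContinuousAt (fun t : ℝ => t ^ κ / c) 0 :=
        (Real.continuousAt_rpow_const 0 κ (Or.inr hκ.le)).div_const c
      have h4 := h3.tendsto
      simp only [Real.zero_rpow hκ.ne', zero_div] at h4
      exact h4.mono_left nhdsWithin_le_nhds
    simpa using ENNReal.tendsto_ofReal h2
  refine tendsto_of_tendsto_of_tendsto_of_le_of_le' tendsto_const_nhds h1
    (Eventually.of_forall fun _ => zero_le) ?_
  filter_upwards [self_mem_nhdsWithin] with t ht
  have ht : 0 < t := ht
  exact iSup_le fun x => ENNReal.ofReal_le_ofReal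
    (div_le_div_of_nonneg_left (by positivity) hc (hφ x t ht))

end

/-! ### Measurable representatives and pointwise domination of the operators -/

section

variable {n : ℕ} {𝕜 : Type*} [RCLike 𝕜]

/-- A homogeneous function in `L_s` of the sphere has an everywhere homogeneous and measurable
representative. -/
theorem exists_measurable_homogZero [NeZero n] {Ω : EuclideanSpace ℝ (Fin n) → 𝕜} {s : ℝ≥0∞}
    (hΩs : MemLpSphere Ω s) (hΩ : HomogZero Ω) :
    ∃ Ω' : EuclideanSpace ℝ (Fin n) → 𝕜, Measurable Ω' ∧ HomogZero Ω' ∧ MemLpSphere Ω' s ∧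
      Ω =ᵐ[volume] Ω' := by
  set ω := hΩs.1.mk
  have hω : Measurable ω := hΩs.1.stronglyMeasurable_mk.measurable
  have hae := hΩs.1.ae_eq_mk
  set e := homeomorphUnitSphereProd (EuclideanSpace ℝ (Fin n)) with he
  set g : ({(0)}ᶜ : Set (EuclideanSpace ℝ (Fin n))) → 𝕜 := fun x => ω (e x).1 with hg
  have hgm : Measurable g := hω.comp (by fun_prop)
  -- The representative on the sphere is extended radially. The value 0 at the origin is immaterial:
  -- homogeneity ignores that point, and it is null.
  set Ω' : EuclideanSpace ℝ (Fin n) → 𝕜 := Function.extend Subtype.val g (fun _ => 0) with hΩ'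
  have hms : MeasurableSet ({(0)}ᶜ : Set (EuclideanSpace ℝ (Fin n))) :=
    (measurableSet_singleton _).compl
  have hval : ∀ x : ({(0)}ᶜ : Set (EuclideanSpace ℝ (Fin n))), Ω' x = ω (e x).1 := fun x =>
    Subtype.val_injective.extend_apply g _ x
  have hinv : ∀ x : ({(0)}ᶜ : Set (EuclideanSpace ℝ (Fin n))), Ω (e x).1 = Ω x := fun x => by
    have hx : (x : EuclideanSpace ℝ (Fin n)) ≠ 0 := x.2
    rw [he, homeomorphUnitSphereProd_apply_fst_coe]
    exact hΩ _ (inv_pos.2 (norm_pos_iff.2 hx)) _ hx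
  have hsph : ∀ θ : Metric.sphere (0 : EuclideanSpace ℝ (Fin n)) 1, Ω' θ = ω θ := fun θ => by
    have hθ : (θ : EuclideanSpace ℝ (Fin n)) ≠ 0 := by
      intro h
      have := θ.2
      simp [h] at this
    rw [hval ⟨θ, hθ⟩]
    congr 1
    ext1
    simp [he]
  refine ⟨Ω', (MeasurableEmbedding.subtype_coe hms).measurable_extend hgm measurable_const,
    ?_, ?_, ?_⟩
  · intro c hc x hx
    have hcx : c • x ≠ 0 := smul_ne_zero hc.ne' hx
    rw [hval ⟨x, hx⟩, hval ⟨c • x, hcx⟩]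
    congr 1
    ext1
    simp [he, norm_smul, smul_smul, abs_of_pos hc]
    congr 1
    field_simp
  · unfold MemLpSphere
    simp only [hsph]
    exact hΩs.ae_eq hae
  · have hmp := (volume : Measure
      (EuclideanSpace ℝ (Fin n))).measurePreserving_homeomorphUnitSphereProd
    -- A null set of directions spans a null cone.
    have h1 := hmp.quasiMeasurePreserving.ae (Measure.quasiMeasurePreserving_fst.ae hae)
    have h2 : ∀ᵐ x ∂(volume : Measure (EuclideanSpace ℝ (Fin n))).restrict {(0)}ᶜ, Ω x = Ω' x := by
      rw [ae_restrict_iff_subtype hms]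
      filter_upwards [h1] with x hx
      rw [hval, ← hinv]
      exact hx
    rwa [restrict_compl_singleton] at h2

/-- For each fixed x the map y ↦ x - y preserves measure. Modifying Ω on a null set thus leaves the
operators unchanged at every x, not just almost every x. -/
theorem ae_eq_sub_left {Y : Type*} {Ω Ω' : EuclideanSpace ℝ (Fin n) → Y} (h : Ω =ᵐ[volume] Ω')
    (x : EuclideanSpace ℝ (Fin n)) : ∀ᵐ y, Ω (x - y) = Ω' (x - y) :=
  (Measure.measurePreserving_sub_left volume x).quasiMeasurePreserving.ae h

section Congr

variable {Ω Ω' f f' : EuclideanSpace ℝ (Fin n) → 𝕜}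

theorem fracIntegral_congr_ae (hΩ : Ω =ᵐ[volume] Ω') (hf : f =ᵐ[volume] f') (α : ℝ) :
    fracIntegral Ω α f = fracIntegral Ω' α f' := by
  ext x
  refine integral_congr_ae ?_
  filter_upwards [ae_eq_sub_left hΩ x, hf] with y h1 h2
  rw [h1, h2]

theorem fracIntegralConverges_congr_ae (hΩ : Ω =ᵐ[volume] Ω') (hf : f =ᵐ[volume] f') (α : ℝ)
    (x : EuclideanSpace ℝ (Fin n)) :
    FracIntegralConverges Ω α f x ↔ FracIntegralConverges Ω' α f' x := by
  refine integrable_congr ?_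
  filter_upwards [ae_eq_sub_left hΩ x, hf] with y h1 h2
  rw [h1, h2]

theorem fracMaximal_congr_ae (hΩ : Ω =ᵐ[volume] Ω') (hf : f =ᵐ[volume] f') (α : ℝ) :
    fracMaximal Ω α f = fracMaximal Ω' α f' := by
  ext x
  refine iSup_congr fun t => iSup_congr fun _ => ?_
  congr 1
  refine lintegral_congr_ae (ae_restrict_of_ae ?_)
  filter_upwards [ae_eq_sub_left hΩ x, hf] with y h1 h2
  rw [h1, h2]

end Congr

section Pointwise

variable {Ω f : EuclideanSpace ℝ (Fin n) → 𝕜} {α : ℝ}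

theorem enorm_div_ofReal_rpow (a : 𝕜) (z : EuclideanSpace ℝ (Fin n)) (β : ℝ) :
    ‖a / ((‖z‖ ^ β : ℝ) : 𝕜)‖ₑ = ‖a‖ₑ * ENNReal.ofReal (‖z‖ ^ (-β)) := by
  rw [div_eq_mul_inv, ← RCLike.ofReal_inv, ← Real.rpow_neg (norm_nonneg z), enorm_mul]
  congr 1
  rw [← ofReal_norm, RCLike.norm_ofReal, abs_of_nonneg (by positivity)]

theorem lintegral_enorm_fracIntegral (x : EuclideanSpace ℝ (Fin n)) :
    ∫⁻ y, ‖(Ω (x - y) / ((‖x - y‖ ^ ((n : ℝ) - α) : ℝ) : 𝕜)) * f y‖ₑ =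
      conv (roughKernel (fun z => ‖Ω z‖ₑ) (n - α)) (fun y => ‖f y‖ₑ) x := by
  refine lintegral_congr fun y => ?_
  rw [enorm_mul, enorm_div_ofReal_rpow]
  rfl

theorem enorm_fracIntegral_le (x : EuclideanSpace ℝ (Fin n)) :
    ‖fracIntegral Ω α f x‖ₑ ≤
      conv (roughKernel (fun z => ‖Ω z‖ₑ) (n - α)) (fun y => ‖f y‖ₑ) x :=
  (enorm_integral_le_lintegral_enorm _).trans_eq (lintegral_enorm_fracIntegral x)

theorem measurable_fracIntegrand (hΩ : Measurable Ω) (hf : Measurable f) (α : ℝ) :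
    Measurable fun z : EuclideanSpace ℝ (Fin n) × EuclideanSpace ℝ (Fin n) =>
      (Ω (z.1 - z.2) / ((‖z.1 - z.2‖ ^ ((n : ℝ) - α) : ℝ) : 𝕜)) * f z.2 := by
  refine Measurable.mul (Measurable.div (by fun_prop) ?_) (by fun_prop)
  exact RCLike.measurable_ofReal.comp (by fun_prop)

theorem fracIntegralConverges_of_lt_top (hΩ : Measurable Ω) (hf : Measurable f)
    {x : EuclideanSpace ℝ (Fin n)}
    (h : conv (roughKernel (fun z => ‖Ω z‖ₑ) (n - α)) (fun y => ‖f y‖ₑ) x < ∞) :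
    FracIntegralConverges Ω α f x := by
  refine ⟨((measurable_fracIntegrand hΩ hf α).comp
    measurable_prodMk_left).aestronglyMeasurable, ?_⟩
  rw [HasFiniteIntegral, lintegral_enorm_fracIntegral]
  exact h

theorem aestronglyMeasurable_fracIntegral (hΩ : Measurable Ω) (hf : Measurable f) (α : ℝ) :
    AEStronglyMeasurable (fracIntegral Ω α f) volume :=
  (StronglyMeasurable.integral_prod_right
    (f := fun x y => (Ω (x - y) / ((‖x - y‖ ^ ((n : ℝ) - α) : ℝ) : 𝕜)) * f y)
    (measurable_fracIntegrand hΩ hf α).stronglyMeasurable).aestronglyMeasurable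

/-- Since |x - y| ≤ t on the ball and α - n < 0, the normalization t^{α-n} is at most |x - y|^{α-n}.
-/
theorem fracMaximal_le [NeZero n] (hαn : α < n) (x : EuclideanSpace ℝ (Fin n)) :
    fracMaximal Ω α f x ≤ volume (Metric.ball (0 : EuclideanSpace ℝ (Fin n)) 1) ^ (-1 + α / (n : ℝ))
      * conv (roughKernel (fun z => ‖Ω z‖ₑ) (n - α)) (fun y => ‖f y‖ₑ) x := by
  have hn : 0 < (n : ℝ) := Nat.cast_pos.2 (Nat.pos_of_ne_zero (NeZero.ne n))
  set V := volume (Metric.ball (0 : EuclideanSpace ℝ (Fin n)) 1)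
  have hV0 : V ≠ 0 := (Metric.measure_ball_pos _ _ one_pos).ne'
  have hVt : V ≠ ∞ := measure_ball_lt_top.ne
  refine iSup_le fun t => iSup_le fun ht => ?_
  rw [volume_ball_eq x ht, mul_comm (ENNReal.ofReal _),
    ENNReal.mul_rpow_of_ne_top hVt ENNReal.ofReal_ne_top,
    ENNReal.ofReal_rpow_of_pos (by positivity), ← Real.rpow_mul ht.le, mul_assoc]
  refine mul_le_mul_right ?_ _
  rw [← lintegral_const_mul' _ _ ENNReal.ofReal_ne_top,
    ← lintegral_indicator Metric.isOpen_ball.measurableSet]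
  refine lintegral_mono_ae ?_
  -- At y = x the real power of 0 with negative exponent is 0 by convention, so the comparison can
  -- fail there; the point is null.
  have hx : ∀ᵐ y : EuclideanSpace ℝ (Fin n), y ≠ x := by
    simp [ae_iff]
  filter_upwards [hx] with y hyx
  by_cases hy : y ∈ Metric.ball x t
  · rw [indicator_of_mem hy, ← mul_assoc, roughKernel, mul_comm (ENNReal.ofReal _)]
    gcongr
    rw [show (n : ℝ) * (-1 + α / n) = -(n - α) by field_simp; ring]
    refine Real.rpow_le_rpow_of_nonpos (norm_pos_iff.2 (sub_ne_zero.2 hyx.symm)) ?_ (by linarith)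
    rw [← dist_eq_norm, dist_comm]
    exact (Metric.mem_ball.1 hy).le
  · rw [indicator_of_notMem hy]
    exact zero_le

/-- The supremum in the fractional maximal function may be taken over rational radii. -/
theorem fracMaximal_eq_iSup_rat [NeZero n] (hαn : α < n) (x : EuclideanSpace ℝ (Fin n)) :
    fracMaximal Ω α f x = ⨆ (k : ℚ) (_ : 0 < k),
      volume (Metric.ball x (k : ℝ)) ^ (-1 + α / (n : ℝ)) *
        ∫⁻ y in Metric.ball x (k : ℝ), ‖Ω (x - y)‖ₑ * ‖f y‖ₑ := by
  have hn : 0 < (n : ℝ) := Nat.cast_pos.2 (Nat.pos_of_ne_zero (NeZero.ne n))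
  have he : -1 + α / (n : ℝ) ≤ 0 := by
    have : α / n < 1 := by rwa [div_lt_one hn]
    linarith
  refine le_antisymm (iSup_le fun t => iSup_le fun ht => ?_) (iSup_le fun k => iSup_le fun hk => ?_)
  -- The rational balls of radius below t exhaust B(x,t), so their integrals converge monotonically,
  -- and their smaller volumes enter with a nonpositive power.
  · have hunion : Metric.ball x t =
        ⋃ k : {k : ℚ // 0 < k ∧ (k : ℝ) < t}, Metric.ball x ((k : ℚ) : ℝ) := by
      ext y
      simp only [Metric.mem_ball, mem_iUnion]
      constructor
      · intro hy
        obtain ⟨k, hk1, hk2⟩ := exists_rat_btwn hy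
        exact ⟨⟨k, by exact_mod_cast dist_nonneg.trans_lt hk1, hk2⟩, hk1⟩
      · rintro ⟨k, hk⟩
        exact hk.trans k.2.2
    have hdir : Directed (· ⊆ ·)
        fun k : {k : ℚ // 0 < k ∧ (k : ℝ) < t} => Metric.ball x ((k : ℚ) : ℝ) := by
      refine Monotone.directed_le fun a b hab => Metric.ball_subset_ball ?_
      exact_mod_cast hab
    have heq : ∫⁻ y in Metric.ball x t, ‖Ω (x - y)‖ₑ * ‖f y‖ₑ =
        ⨆ k : {k : ℚ // 0 < k ∧ (k : ℝ) < t},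
          ∫⁻ y in Metric.ball x ((k : ℚ) : ℝ), ‖Ω (x - y)‖ₑ * ‖f y‖ₑ := by
      rw [hunion]
      exact setLIntegral_iUnion_of_directed _ hdir
    rw [heq, ENNReal.mul_iSup]
    refine iSup_le fun k => ?_
    refine le_iSup₂_of_le k.1 k.2.1 (mul_le_mul_left ?_ _)
    have hk : volume (Metric.ball x ((k : ℚ) : ℝ)) ≤ volume (Metric.ball x t) :=
      measure_mono (Metric.ball_subset_ball k.2.2.le)
    rw [show -1 + α / (n : ℝ) = -(1 - α / n) by ring, ENNReal.rpow_neg, ENNReal.rpow_neg]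
    exact ENNReal.inv_le_inv.2 (ENNReal.rpow_le_rpow hk (by linarith))
  · exact le_iSup₂_of_le (f := fun (t : ℝ) (_ : 0 < t) =>
      volume (Metric.ball x t) ^ (-1 + α / (n : ℝ)) *
        ∫⁻ y in Metric.ball x t, ‖Ω (x - y)‖ₑ * ‖f y‖ₑ) (k : ℝ) (by exact_mod_cast hk) le_rfl

theorem measurable_fracMaximal [NeZero n] (hΩ : Measurable Ω) (hf : Measurable f) (hαn : α < n) :
    Measurable (fracMaximal Ω α f) := by
  have : fracMaximal Ω α f = fun x => ⨆ (k : ℚ) (_ : 0 < k),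
      volume (Metric.ball x (k : ℝ)) ^ (-1 + α / (n : ℝ)) *
        ∫⁻ y in Metric.ball x (k : ℝ), ‖Ω (x - y)‖ₑ * ‖f y‖ₑ :=
    funext fun x => fracMaximal_eq_iSup_rat hαn x
  rw [this]
  refine Measurable.iSup fun k => Measurable.iSup fun hk => ?_
  -- By translation invariance the volume factor is constant in x, leaving an integral with
  -- parameter.
  simp only [Measure.addHaar_ball_center volume _ (k : ℝ)]
  refine Measurable.const_mul ?_ _
  have hS : MeasurableSet {z : EuclideanSpace ℝ (Fin n) × EuclideanSpace ℝ (Fin n) |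
      dist z.2 z.1 < k} := measurableSet_lt (by fun_prop) (by fun_prop)
  have hG : Measurable ({z : EuclideanSpace ℝ (Fin n) × EuclideanSpace ℝ (Fin n) |
      dist z.2 z.1 < k}.indicator fun z => ‖Ω (z.1 - z.2)‖ₑ * ‖f z.2‖ₑ) :=
    Measurable.indicator (by fun_prop) hS
  have := hG.lintegral_prod_right' (ν := volume)
  convert this using 2 with x
  rw [← lintegral_indicator Metric.isOpen_ball.measurableSet]
  rfl

end Pointwise

end

/-! ### Transfer from the local estimate to vanishing Morrey spaces -/

section

variable {n : ℕ}

theorem ae_lt_top_of_ballNorm_lt_top {H : EuclideanSpace ℝ (Fin n) → ℝ≥0∞} (hH : Measurable H)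
    {q : ℝ} (hq : 0 < q) (h : ∀ R, 0 < R → ballNorm q H 0 R < ∞) : ∀ᵐ x, H x < ∞ := by
  rw [← Measure.restrict_univ (μ := (volume : Measure (EuclideanSpace ℝ (Fin n)))),
    ← Metric.iUnion_ball_nat_succ (0 : EuclideanSpace ℝ (Fin n)), ae_restrict_iUnion_iff]
  intro k
  have h1 := h (k + 1) (by positivity)
  rw [ballNorm, ENNReal.rpow_lt_top_iff_of_pos (by positivity)] at h1
  filter_upwards [ae_lt_top (hH.pow_const q) h1.ne] with x hx
  exact (ENNReal.rpow_lt_top_iff_of_pos hq).1 hx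

theorem ballNorm_enorm {ε : Type*} [ENorm ε] {p : ℝ} (hp : 0 < p)
    (f : EuclideanSpace ℝ (Fin n) → ε) (x : EuclideanSpace ℝ (Fin n)) (t : ℝ) :
    ballNorm p (fun y => ‖f y‖ₑ) x t =
      eLpNorm f (ENNReal.ofReal p) (volume.restrict (Metric.ball x t)) := by
  rw [eLpNorm_eq_lintegral_rpow_enorm_toReal (by simpa using hp) ENNReal.ofReal_ne_top,
    ENNReal.toReal_ofReal hp.le]
  rfl

theorem eLpNorm_le_mul_ballNorm {ε : Type*} [ENorm ε] {q : ℝ} (hq : 0 < q)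
    {G : EuclideanSpace ℝ (Fin n) → ε} {H : EuclideanSpace ℝ (Fin n) → ℝ≥0∞} (hH : Measurable H)
    {v : ℝ≥0∞} (h : ∀ x, ‖G x‖ₑ ≤ v * H x) (x : EuclideanSpace ℝ (Fin n)) (t : ℝ) :
    eLpNorm G (ENNReal.ofReal q) (volume.restrict (Metric.ball x t)) ≤ v * ballNorm q H x t := by
  rw [← ballNorm_enorm hq]
  refine (ballNorm_mono_fun hq h x t).trans_eq ?_
  simp only [ballNorm, ENNReal.mul_rpow_of_nonneg _ _ hq.le]
  rw [lintegral_const_mul _ (hH.pow_const q), ENNReal.mul_rpow_of_nonneg _ _ (by positivity),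
    ← ENNReal.rpow_mul, show q * (1 / q) = 1 by field_simp, ENNReal.rpow_one]

theorem MemLpLoc.aestronglyMeasurable {ε : Type*} [TopologicalSpace ε] [ContinuousENorm ε]
    [TopologicalSpace.PseudoMetrizableSpace ε] {p : ℝ} {f : EuclideanSpace ℝ (Fin n) → ε}
    (hf : MemLpLoc p f) : AEStronglyMeasurable f volume := by
  rw [← Measure.restrict_univ (μ := (volume : Measure (EuclideanSpace ℝ (Fin n)))),
    ← Metric.iUnion_ball_nat (0 : EuclideanSpace ℝ (Fin n)), aestronglyMeasurable_iUnion_iff]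
  intro k
  exact (hf _ (isCompact_closedBall 0 (k : ℝ))).1.mono_measure
    (Measure.restrict_mono_set _ Metric.ball_subset_closedBall)

section Transfer

variable {ε ε' : Type*} [ENorm ε] [TopologicalSpace ε'] [ContinuousENorm ε'] {p q κ : ℝ}
  {φ₁ φ₂ : EuclideanSpace ℝ (Fin n) → ℝ → ℝ} {f : EuclideanSpace ℝ (Fin n) → ε}
  {G : EuclideanSpace ℝ (Fin n) → ε'} {A C₀ : ℝ≥0}

theorem eLpNorm_ball_le_of_localQuot_le (hφ : IsWeight φ₁) {x : EuclideanSpace ℝ (Fin n)} {t : ℝ}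
    (ht : 0 < t) {M : ℝ≥0∞} (h : localQuot p φ₁ f x t ≤ M) :
    eLpNorm f (ENNReal.ofReal p) (volume.restrict (Metric.ball x t)) ≤
      M * ENNReal.ofReal (φ₁ x t) := by
  have h0 : ENNReal.ofReal (φ₁ x t) ≠ 0 := by simpa using hφ.1 x t ht
  exact (ENNReal.div_le_iff h0 ENNReal.ofReal_ne_top).1 h

theorem localQuot_le_morreyNorm {x : EuclideanSpace ℝ (Fin n)} {t : ℝ} (ht : 0 < t) :
    localQuot p φ₁ f x t ≤ morreyNorm p φ₁ f :=
  le_iSup₂_of_le (f := fun x t => ⨆ (_ : 0 < t), localQuot p φ₁ f x t) x t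
    (le_iSup_of_le ht le_rfl)

theorem ofReal_rpow_mul_ofReal_div {r : ℝ} (hr : 0 < r) (y : ℝ) :
    ENNReal.ofReal (r ^ κ) * ENNReal.ofReal (y / r ^ κ) = ENNReal.ofReal y := by
  have : 0 < r ^ κ := by positivity
  rw [← ENNReal.ofReal_mul this.le]
  congr 1; field_simp

/-- The bound on balls given by the local estimate and the tail condition. -/
theorem eLpNorm_ball_le_morreyNorm (hφ₁ : IsWeight φ₁)
    (htail : ∀ (x : EuclideanSpace ℝ (Fin n)) (r : ℝ), 0 < r →
      ∫⁻ t in Ioi r, ENNReal.ofReal (φ₁ x t) * ENNReal.ofReal (t ^ (-κ - 1)) ≤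
        C₀ * ENNReal.ofReal (φ₂ x r / r ^ κ))
    (hG : ∀ x R, 0 < R → eLpNorm G (ENNReal.ofReal q) (volume.restrict (Metric.ball x R)) ≤
      A * ENNReal.ofReal (R ^ κ) * ∫⁻ t in Ioi R, ENNReal.ofReal (t ^ (-κ - 1)) *
        eLpNorm f (ENNReal.ofReal p) (volume.restrict (Metric.ball x t)))
    (hM : morreyNorm p φ₁ f < ∞) {x : EuclideanSpace ℝ (Fin n)} {R : ℝ} (hR : 0 < R) :
    eLpNorm G (ENNReal.ofReal q) (volume.restrict (Metric.ball x R)) ≤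
      A * C₀ * morreyNorm p φ₁ f * ENNReal.ofReal (φ₂ x R) := by
  set M := morreyNorm p φ₁ f
  calc _ ≤ _ := hG x R hR
    _ ≤ A * ENNReal.ofReal (R ^ κ) * ∫⁻ t in Ioi R,
        M * (ENNReal.ofReal (φ₁ x t) * ENNReal.ofReal (t ^ (-κ - 1))) := by
        refine mul_le_mul_right (setLIntegral_mono' measurableSet_Ioi fun t ht => ?_) _
        refine (mul_le_mul_right (eLpNorm_ball_le_of_localQuot_le hφ₁ (hR.trans ht)
          (localQuot_le_morreyNorm (hR.trans ht))) _).trans_eq ?_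
        ring
    _ ≤ A * ENNReal.ofReal (R ^ κ) * (M * (C₀ * ENNReal.ofReal (φ₂ x R / R ^ κ))) := by
        rw [lintegral_const_mul' _ _ hM.ne]
        gcongr
        exact htail x R hR
    _ = A * C₀ * M * (ENNReal.ofReal (R ^ κ) * ENNReal.ofReal (φ₂ x R / R ^ κ)) := by ring
    _ = _ := by rw [ofReal_rpow_mul_ofReal_div hR]

theorem morreyNorm_le_of_local (hφ₁ : IsWeight φ₁)
    (htail : ∀ (x : EuclideanSpace ℝ (Fin n)) (r : ℝ), 0 < r →
      ∫⁻ t in Ioi r, ENNReal.ofReal (φ₁ x t) * ENNReal.ofReal (t ^ (-κ - 1)) ≤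
        C₀ * ENNReal.ofReal (φ₂ x r / r ^ κ))
    (hG : ∀ x R, 0 < R → eLpNorm G (ENNReal.ofReal q) (volume.restrict (Metric.ball x R)) ≤
      A * ENNReal.ofReal (R ^ κ) * ∫⁻ t in Ioi R, ENNReal.ofReal (t ^ (-κ - 1)) *
        eLpNorm f (ENNReal.ofReal p) (volume.restrict (Metric.ball x t)))
    (hM : morreyNorm p φ₁ f < ∞) :
    morreyNorm q φ₂ G ≤ A * C₀ * morreyNorm p φ₁ f :=
  iSup_le fun _ => iSup_le fun _ => iSup_le fun hR =>
    ENNReal.div_le_of_le_mul (eLpNorm_ball_le_morreyNorm hφ₁ htail hG hM hR)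

/-- The bound for small balls: the part of the tail below `δ` is small and the rest is finite. -/
theorem localQuot_le_of_small (hφ₁ : IsWeight φ₁) (hφ₂ : IsWeight φ₂)
    (htail : ∀ (x : EuclideanSpace ℝ (Fin n)) (r : ℝ), 0 < r →
      ∫⁻ t in Ioi r, ENNReal.ofReal (φ₁ x t) * ENNReal.ofReal (t ^ (-κ - 1)) ≤
        C₀ * ENNReal.ofReal (φ₂ x r / r ^ κ))
    (hG : ∀ x R, 0 < R → eLpNorm G (ENNReal.ofReal q) (volume.restrict (Metric.ball x R)) ≤
      A * ENNReal.ofReal (R ^ κ) * ∫⁻ t in Ioi R, ENNReal.ofReal (t ^ (-κ - 1)) *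
        eLpNorm f (ENNReal.ofReal p) (volume.restrict (Metric.ball x t)))
    (hM : morreyNorm p φ₁ f < ∞) {η : ℝ≥0∞} (hη : η ≠ ∞) {δ : ℝ} (hδ : 0 < δ)
    (hsmall : ∀ x t, 0 < t → t ≤ δ → localQuot p φ₁ f x t ≤ η)
    {x : EuclideanSpace ℝ (Fin n)} {R : ℝ} (hR : 0 < R) :
    localQuot q φ₂ G x R ≤ A * C₀ * η + A * (morreyNorm p φ₁ f *
      ∫⁻ t in Ioi δ, (⨆ x : EuclideanSpace ℝ (Fin n), ENNReal.ofReal (φ₁ x t)) *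
      ENNReal.ofReal (t ^ (-κ - 1))) * ENNReal.ofReal (R ^ κ / φ₂ x R) := by
  set M := morreyNorm p φ₁ f
  set J := ∫⁻ t in Ioi δ, (⨆ x : EuclideanSpace ℝ (Fin n), ENNReal.ofReal (φ₁ x t)) *
      ENNReal.ofReal (t ^ (-κ - 1))
  have hφpos := hφ₂.1 x R hR
  set N : ℝ → ℝ≥0∞ := fun t => ENNReal.ofReal (t ^ (-κ - 1)) *
        eLpNorm f (ENNReal.ofReal p) (volume.restrict (Metric.ball x t)) with hN
  have h1 : ∫⁻ t in Ioc R δ, N t ≤ η * (C₀ * ENNReal.ofReal (φ₂ x R / R ^ κ)) := by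
    calc _ ≤ ∫⁻ t in Ioc R δ, η * (ENNReal.ofReal (φ₁ x t) * ENNReal.ofReal (t ^ (-κ - 1))) := by
          refine setLIntegral_mono' measurableSet_Ioc fun t ht => ?_
          refine (mul_le_mul_right (eLpNorm_ball_le_of_localQuot_le hφ₁ (hR.trans ht.1)
            (hsmall x t (hR.trans ht.1) ht.2)) _).trans_eq ?_
          ring
      _ ≤ ∫⁻ t in Ioi R, η * (ENNReal.ofReal (φ₁ x t) * ENNReal.ofReal (t ^ (-κ - 1))) :=
          lintegral_mono_set Ioc_subset_Ioi_self
      _ ≤ _ := by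
          rw [lintegral_const_mul' _ _ hη]
          gcongr
          exact htail x R hR
  have h2 : ∫⁻ t in Ioi δ, N t ≤ M * J := by
    rw [← lintegral_const_mul' _ _ hM.ne]
    refine setLIntegral_mono' measurableSet_Ioi fun t ht => ?_
    have ht0 : 0 < t := hδ.trans ht
    calc _ ≤ ENNReal.ofReal (t ^ (-κ - 1)) * (M * ENNReal.ofReal (φ₁ x t)) :=
          mul_le_mul_right (eLpNorm_ball_le_of_localQuot_le hφ₁ ht0
            (localQuot_le_morreyNorm ht0)) _
      -- Passing to the supremum over centres makes the constant J independent of x, as the uniform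
      -- limit requires.
      _ ≤ ENNReal.ofReal (t ^ (-κ - 1)) *
          (M * ⨆ x : EuclideanSpace ℝ (Fin n), ENNReal.ofReal (φ₁ x t)) := by
          gcongr
          exact le_iSup (fun x => ENNReal.ofReal (φ₁ x t)) x
      _ = _ := by ring
  -- No relation between R and δ is assumed; if δ ≤ R the first range is empty.
  have h3 : ∫⁻ t in Ioi R, N t ≤ η * (C₀ * ENNReal.ofReal (φ₂ x R / R ^ κ)) + M * J :=
    (lintegral_mono_set Ioi_subset_Ioc_union_Ioi).trans
      ((lintegral_union_le _ _ _).trans (add_le_add h1 h2))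
  refine ENNReal.div_le_of_le_mul ?_
  calc _ ≤ _ := hG x R hR
    _ ≤ A * ENNReal.ofReal (R ^ κ) *
        (η * (C₀ * ENNReal.ofReal (φ₂ x R / R ^ κ)) + M * J) := mul_le_mul_right h3 _
    _ = A * C₀ * η * (ENNReal.ofReal (R ^ κ) * ENNReal.ofReal (φ₂ x R / R ^ κ)) +
        A * (M * J) * ENNReal.ofReal (R ^ κ) := by ring
    _ = A * C₀ * η * ENNReal.ofReal (φ₂ x R) + A * (M * J) *
        (ENNReal.ofReal (R ^ κ / φ₂ x R) * ENNReal.ofReal (φ₂ x R)) := by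
        rw [ofReal_rpow_mul_ofReal_div hR, ← ENNReal.ofReal_mul (by positivity),
          div_mul_cancel₀ _ hφpos.ne']
    _ = _ := by ring

/-- The local estimate and the conditions on the weights give the vanishing property. -/
theorem memVanishingMorrey_of_local (hφ₁ : IsWeight φ₁) (hφ₂ : IsWeight φ₂)
    (hsup : SupTailFinite κ φ₁)
    (htail : ∀ (x : EuclideanSpace ℝ (Fin n)) (r : ℝ), 0 < r →
      ∫⁻ t in Ioi r, ENNReal.ofReal (φ₁ x t) * ENNReal.ofReal (t ^ (-κ - 1)) ≤
        C₀ * ENNReal.ofReal (φ₂ x r / r ^ κ))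
    (hlim : Tendsto (fun t : ℝ => ⨆ x : EuclideanSpace ℝ (Fin n),
      ENNReal.ofReal (t ^ κ / φ₂ x t)) (𝓝[>] 0) (𝓝 0))
    (hG : ∀ x R, 0 < R → eLpNorm G (ENNReal.ofReal q) (volume.restrict (Metric.ball x R)) ≤
      A * ENNReal.ofReal (R ^ κ) * ∫⁻ t in Ioi R, ENNReal.ofReal (t ^ (-κ - 1)) *
        eLpNorm f (ENNReal.ofReal p) (volume.restrict (Metric.ball x t)))
    (hGm : AEStronglyMeasurable G volume)
    (hM : morreyNorm p φ₁ f < ∞)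
    (hf : Tendsto (fun r : ℝ => ⨆ x : EuclideanSpace ℝ (Fin n), localQuot p φ₁ f x r)
      (𝓝[>] 0) (𝓝 0)) :
    MemVanishingMorrey q φ₂ G := by
  refine ⟨⟨fun K hK => ⟨hGm.restrict, ?_⟩, ?_⟩, ?_⟩
  · obtain ⟨R, hR, hKR⟩ := hK.isBounded.subset_ball_lt 0 0
    refine (eLpNorm_mono_measure G (Measure.restrict_mono_set _ hKR)).trans_lt ?_
    refine (eLpNorm_ball_le_morreyNorm hφ₁ htail hG hM hR).trans_lt ?_
    exact ENNReal.mul_lt_top (ENNReal.mul_lt_top (ENNReal.mul_lt_top ENNReal.coe_lt_top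
      ENNReal.coe_lt_top) hM) ENNReal.ofReal_lt_top
  · refine (morreyNorm_le_of_local hφ₁ htail hG hM).trans_lt ?_
    exact ENNReal.mul_lt_top (ENNReal.mul_lt_top ENNReal.coe_lt_top ENNReal.coe_lt_top) hM
  · rw [ENNReal.tendsto_nhds_zero]
    intro e he
    rcases eq_or_ne e ∞ with rfl | het
    · simp
    -- The budget is A C₀ η for radii below the cut and η for the rest, in total at most e.
    set η : ℝ≥0∞ := e / (A * C₀ + 1) with hη
    have hden : (A * C₀ + 1 : ℝ≥0∞) ≠ ∞ :=
      ENNReal.add_ne_top.2 ⟨ENNReal.mul_ne_top ENNReal.coe_ne_top ENNReal.coe_ne_top, by simp⟩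
    have hη0 : 0 < η := ENNReal.div_pos he.ne' hden
    have hηt : η ≠ ∞ := ENNReal.div_ne_top het (by simp)
    obtain ⟨δ, hδ, hδs⟩ := mem_nhdsGT_iff_exists_Ioo_subset.1
      (ENNReal.tendsto_nhds_zero.1 hf η hη0)
    have hδ : 0 < δ := hδ
    -- Halving δ passes from the open interval (0, δ) to a closed condition on t.
    have hsmall : ∀ x t, 0 < t → t ≤ δ / 2 → localQuot p φ₁ f x t ≤ η := fun x t ht htd =>
      (le_iSup (fun x => localQuot p φ₁ f x t) x).trans (hδs ⟨ht, by linarith⟩)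
    set c : ℝ≥0∞ := A * (morreyNorm p φ₁ f * ∫⁻ t in Ioi (δ / 2),
      (⨆ x : EuclideanSpace ℝ (Fin n), ENNReal.ofReal (φ₁ x t)) * ENNReal.ofReal (t ^ (-κ - 1)))
    have hc : c ≠ ∞ := ENNReal.mul_ne_top ENNReal.coe_ne_top
      (ENNReal.mul_ne_top hM.ne (hsup _ (by positivity)).ne)
    have hlim' := ENNReal.Tendsto.const_mul hlim (Or.inr hc : (0 : ℝ≥0∞) ≠ 0 ∨ c ≠ ∞)
    rw [mul_zero] at hlim'
    filter_upwards [self_mem_nhdsWithin, ENNReal.tendsto_nhds_zero.1 hlim' η hη0] with R hR hRη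
    refine iSup_le fun x => ?_
    calc _ ≤ A * C₀ * η + c * ENNReal.ofReal (R ^ κ / φ₂ x R) :=
          localQuot_le_of_small hφ₁ hφ₂ htail hG hM hηt (by positivity) hsmall hR
      _ ≤ A * C₀ * η + η := by
          gcongr
          refine le_trans ?_ hRη
          gcongr
          exact le_iSup (fun x => ENNReal.ofReal (R ^ κ / φ₂ x R)) x
      _ = (A * C₀ + 1) * η := by ring
      _ ≤ e := ENNReal.mul_div_le

end Transfer

end

/-! ### Boundedness of both operators -/

section

variable {n : ℕ} {𝕜 : Type*} [RCLike 𝕜]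

/-- Boundedness of both operators, from the exponent and weight conditions with tail exponent
`κ`. -/
theorem bounded_of_tail (Ω : EuclideanSpace ℝ (Fin n) → 𝕜) {s : ℝ≥0∞} (hs : 1 < s)
    (hΩs : MemLpSphere Ω s) (hΩ : HomogZero Ω)
    {α p q κ : ℝ} (hα : 0 < α) (hαn : α < n) (hp : 1 < p) (hpα : p < n / α)
    (hq : 1 / q = 1 / p - α / n)
    {φ₁ φ₂ : EuclideanSpace ℝ (Fin n) → ℝ → ℝ} (hφ₁ : IsWeight φ₁) (hφ₂ : IsWeight φ₂)
    (hcase : (ENNReal.conjExponent s ≤ ENNReal.ofReal p ∧ κ = n / q) ∨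
      (ENNReal.ofReal q < s ∧ κ = n / q - n * (s⁻¹).toReal))
    (hsup : SupTailFinite κ φ₁) (htail : TailBound κ φ₁ φ₂)
    (hlim : Tendsto (fun t : ℝ => ⨆ x : EuclideanSpace ℝ (Fin n),
      ENNReal.ofReal (t ^ κ / φ₂ x t)) (𝓝[>] 0) (𝓝 0)) :
    ∃ C : ℝ≥0, ∀ f : EuclideanSpace ℝ (Fin n) → 𝕜, MemVanishingMorrey p φ₁ f →
      ((∀ᵐ x, fracMaximal Ω α f x < ∞) ∧ MemVanishingMorrey q φ₂ (fracMaximal Ω α f) ∧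
        morreyNorm q φ₂ (fracMaximal Ω α f) ≤ C * morreyNorm p φ₁ f) ∧
      ((∀ᵐ x, FracIntegralConverges Ω α f x) ∧ MemVanishingMorrey q φ₂ (fracIntegral Ω α f) ∧
        morreyNorm q φ₂ (fracIntegral Ω α f) ≤ C * morreyNorm p φ₁ f) := by
  have hn : 0 < (n : ℝ) := hα.trans hαn
  have : NeZero n := ⟨by rintro rfl; simp at hn⟩
  have hp0 : 0 < p := by linarith
  obtain ⟨Ω', hΩ'm, hΩ'h, hΩ's, hΩΩ'⟩ := exists_measurable_homogZero hΩs hΩ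
  set W : EuclideanSpace ℝ (Fin n) → ℝ≥0∞ := fun z => ‖Ω' z‖ₑ with hW
  have hWm : Measurable W := hΩ'm.enorm
  have hWh : HomogZero W := fun c hc x hx => by rw [hW]; simp only [hΩ'h c hc x hx]
  have hWs : MemLp (fun θ : Metric.sphere (0 : EuclideanSpace ℝ (Fin n)) 1 => W θ) s
      (volume : Measure (EuclideanSpace ℝ (Fin n))).toSphere := MemLp.enorm hΩ's
  obtain ⟨hq0, hκ, A, hA⟩ :=
    exists_ballNorm_roughKernel_le hWm hWh hs hWs hα hαn hp hpα hq hcase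
  obtain ⟨C₀, hC₀⟩ := htail
  set V := volume (Metric.ball (0 : EuclideanSpace ℝ (Fin n)) 1) with hV
  have hVt : V ^ (-1 + α / (n : ℝ)) ≠ ∞ := by
    refine ENNReal.rpow_ne_top_of_ne_zero (Metric.measure_ball_pos _ _ one_pos).ne'
      measure_ball_lt_top.ne
  -- Adding 1 makes v ≥ 1, so the same v H dominates the maximal function and the integral operator.
  set v : ℝ≥0 := (V ^ (-1 + α / (n : ℝ))).toNNReal + 1 with hv
  have hv1 : (1 : ℝ≥0∞) ≤ v := by
    rw [hv]; push_cast; exact le_add_self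
  have hvV : V ^ (-1 + α / (n : ℝ)) ≤ v := by
    rw [hv, ENNReal.coe_add, ENNReal.coe_toNNReal hVt]; exact le_self_add
  refine ⟨v * A * C₀, fun f hf => ?_⟩
  have hfm := hf.1.1.aestronglyMeasurable
  set f' := hfm.mk
  have hf'm : Measurable f' := hfm.stronglyMeasurable_mk.measurable
  have hff' : f =ᵐ[volume] f' := hfm.ae_eq_mk
  set F : EuclideanSpace ℝ (Fin n) → ℝ≥0∞ := fun y => ‖f' y‖ₑ
  have hFm : Measurable F := hf'm.enorm
  set H := conv (roughKernel W (n - α)) F with hH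
  have hHm : Measurable H := measurable_conv (measurable_roughKernel hWm _) hFm
  have hFf : ∀ x t, ballNorm p F x t =
      eLpNorm f (ENNReal.ofReal p) (volume.restrict (Metric.ball x t)) := fun x t =>
    (ballNorm_enorm hp0 f' x t).trans (eLpNorm_congr_ae (ae_restrict_of_ae hff'.symm))
  have hHle : ∀ x R, 0 < R → ballNorm q H x R ≤ A * ENNReal.ofReal (R ^ κ) *
      ∫⁻ t in Ioi R, ENNReal.ofReal (t ^ (-κ - 1)) *
        eLpNorm f (ENNReal.ofReal p) (volume.restrict (Metric.ball x t)) := fun x R hR => by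
    simpa only [hFf] using hA F hFm x R hR
  have hM : morreyNorm p φ₁ f < ∞ := hf.1.2
  have hHtop : ∀ᵐ x, H x < ∞ := by
    refine ae_lt_top_of_ballNorm_lt_top hHm hq0 fun R hR => ?_
    have h1 := eLpNorm_ball_le_morreyNorm (G := H) (q := q) hφ₁ hC₀
      (fun x R hR => by rw [← ballNorm_enorm hq0]; exact hHle x R hR) hM (x := 0) hR
    rw [← ballNorm_enorm hq0] at h1
    refine h1.trans_lt (ENNReal.mul_lt_top (ENNReal.mul_lt_top (ENNReal.mul_lt_top
      ENNReal.coe_lt_top ENNReal.coe_lt_top) hM) ENNReal.ofReal_lt_top)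
  have hscale : ∀ {e : ℝ≥0∞} {x R}, 0 < R → e ≤ v * ballNorm q H x R →
      e ≤ ((v * A : ℝ≥0) : ℝ≥0∞) * ENNReal.ofReal (R ^ κ) *
        ∫⁻ t in Ioi R, ENNReal.ofReal (t ^ (-κ - 1)) *
          eLpNorm f (ENNReal.ofReal p) (volume.restrict (Metric.ball x t)) := by
    intro e x R hR he
    refine he.trans ((mul_le_mul_right (hHle x R hR) _).trans_eq ?_)
    rw [ENNReal.coe_mul]; ring
  have hmax : ∀ x, ‖fracMaximal Ω' α f' x‖ₑ ≤ v * H x := fun x => by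
    rw [enorm_eq_self]
    exact (fracMaximal_le hαn x).trans (mul_le_mul_left hvV _)
  have hint : ∀ x, ‖fracIntegral Ω' α f' x‖ₑ ≤ v * H x := fun x =>
    (enorm_fracIntegral_le x).trans (le_mul_of_one_le_left zero_le hv1)
  have hGmax := fun x R (hR : 0 < R) => hscale hR (eLpNorm_le_mul_ballNorm hq0 hHm hmax x R)
  have hGint := fun x R (hR : 0 < R) => hscale hR (eLpNorm_le_mul_ballNorm hq0 hHm hint x R)
  rw [fracMaximal_congr_ae hΩΩ' hff', fracIntegral_congr_ae hΩΩ' hff']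
  simp only [fracIntegralConverges_congr_ae hΩΩ' hff']
  refine ⟨⟨?_, ?_, ?_⟩, ?_, ?_, ?_⟩
  · filter_upwards [hHtop] with x hx
    exact (hmax x).trans_lt (ENNReal.mul_lt_top ENNReal.coe_lt_top hx)
  · exact memVanishingMorrey_of_local hφ₁ hφ₂ hsup hC₀ hlim hGmax
      (measurable_fracMaximal hΩ'm hf'm hαn).aestronglyMeasurable hM hf.2
  · rw [ENNReal.coe_mul]
    exact morreyNorm_le_of_local hφ₁ hC₀ hGmax hM
  · filter_upwards [hHtop] with x hx
    exact fracIntegralConverges_of_lt_top hΩ'm hf'm hx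
  · exact memVanishingMorrey_of_local hφ₁ hφ₂ hsup hC₀ hlim hGint
      (aestronglyMeasurable_fracIntegral hΩ'm hf'm α) hM hf.2
  · rw [ENNReal.coe_mul]
    exact morreyNorm_le_of_local hφ₁ hC₀ hGint hM

end

end RoughMorrey

end

theorem mainTheorem7 {𝕜 : Type*} [RCLike 𝕜] (n : ℕ)
    (Ω : EuclideanSpace ℝ (Fin n) → 𝕜) (s : ℝ≥0∞) (hs : 1 < s)
    (hΩs : RoughMorrey.MemLpSphere Ω s) (hΩ : RoughMorrey.HomogZero Ω)
    (α p q : ℝ) (hα : 0 < α) (hαn : α < n) (hp : 1 < p) (hpα : p < n / α)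
    (hq : 1 / q = 1 / p - α / n)
    (φ₁ φ₂ : EuclideanSpace ℝ (Fin n) → ℝ → ℝ)
    (hφ₁ : RoughMorrey.IsWeight φ₁) (hφ₂ : RoughMorrey.IsWeight φ₂)
    (hadm₁ : RoughMorrey.Admissible p φ₁) (hadm₂ : RoughMorrey.Admissible q φ₂)
    (hcase :
      (ENNReal.conjExponent s ≤ ENNReal.ofReal p ∧
        RoughMorrey.SupTailFinite (n / q) φ₁ ∧
        RoughMorrey.TailBound (n / q) φ₁ φ₂) ∨
      (ENNReal.ofReal q < s ∧
        RoughMorrey.BoundedBelow φ₂ ∧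
        RoughMorrey.SupTailFinite (n / q - n * (s⁻¹).toReal) φ₁ ∧
        RoughMorrey.TailBound (n / q - n * (s⁻¹).toReal) φ₁ φ₂)) :
    (∃ C : ℝ≥0, ∀ f : EuclideanSpace ℝ (Fin n) → 𝕜,
      RoughMorrey.MemVanishingMorrey p φ₁ f →
        (∀ᵐ x, RoughMorrey.fracMaximal Ω α f x < ∞) ∧
        RoughMorrey.MemVanishingMorrey q φ₂ (RoughMorrey.fracMaximal Ω α f) ∧
        RoughMorrey.morreyNorm q φ₂ (RoughMorrey.fracMaximal Ω α f) ≤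
          C * RoughMorrey.morreyNorm p φ₁ f) ∧
    (∃ C : ℝ≥0, ∀ f : EuclideanSpace ℝ (Fin n) → 𝕜,
      RoughMorrey.MemVanishingMorrey p φ₁ f →
        (∀ᵐ x, RoughMorrey.FracIntegralConverges Ω α f x) ∧
        RoughMorrey.MemVanishingMorrey q φ₂ (RoughMorrey.fracIntegral Ω α f) ∧
        RoughMorrey.morreyNorm q φ₂ (RoughMorrey.fracIntegral Ω α f) ≤
          C * RoughMorrey.morreyNorm p φ₁ f) := by
  -- The two cases differ only in κ and in the reason for r^κ/φ₂(x,r) → 0 uniformly in x: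
  -- admissibility of φ₂ in (a), the lower bound on φ₂ together with κ > 0 in (b).
  suffices h : ∃ κ : ℝ, ((ENNReal.conjExponent s ≤ ENNReal.ofReal p ∧ κ = n / q) ∨
      (ENNReal.ofReal q < s ∧ κ = n / q - n * (s⁻¹).toReal)) ∧
      RoughMorrey.SupTailFinite κ φ₁ ∧ RoughMorrey.TailBound κ φ₁ φ₂ ∧
      Tendsto (fun t : ℝ => ⨆ x : EuclideanSpace ℝ (Fin n), ENNReal.ofReal (t ^ κ / φ₂ x t))
        (𝓝[>] 0) (𝓝 0) by
    obtain ⟨κ, hc, hsup, htail, hlim⟩ := h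
    obtain ⟨C, hC⟩ := RoughMorrey.bounded_of_tail Ω hs hΩs hΩ hα hαn hp hpα hq hφ₁ hφ₂ hc hsup
      htail hlim
    exact ⟨⟨C, fun f hf => (hC f hf).1⟩, ⟨C, fun f hf => (hC f hf).2⟩⟩
  rcases hcase with ⟨h, hsup, htail⟩ | ⟨h, hbdd, hsup, htail⟩
  · exact ⟨n / q, Or.inl ⟨h, rfl⟩, hsup, htail, hadm₂.1⟩
  · have hn : 0 < (n : ℝ) := hα.trans hαn
    have hq0 : 0 < q := by
      rw [lt_div_iff₀ hα] at hpα
      have h1 : α / n < 1 / p := by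
        rw [div_lt_div_iff₀ hn (by linarith)]
        linarith
      exact one_div_pos.1 (by linarith)
    have hκ := RoughMorrey.tail_exponent_pos hn hq0 h
    exact ⟨_, Or.inr ⟨h, rfl⟩, hsup, htail, hbdd.tendsto hκ⟩
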